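/- Theorem (Propagation of chaos). For integers $N,M\ge 1$ let $\Omega=\{0,1\}^{\{1,\dots,N\}}\times\{0,\dots,M\}^2$, with elements $\omega=(\eta,n_-,n_+)$, and consider the Markov process on $\Omega$ with generator $$\mathbf L f(\omega)=\tfrac12\sum_{x=1}^{N-1}[f(\omega^{x,x+1})-f(\omega)]+c_N(\omega)[f(\omega^N)-f(\omega)]+c_1(\omega)[f(\omega^1)-f(\omega)],$$ where $\omega^{x,x+1}$ is $\omega$ with $\eta(x)$ and $\eta(x+1)$ exchanged, $c_N(\omega)=\tfrac12(1-\tfrac{n_+}{M})\eta(N)+\tfrac12\tfrac{n_+}{M}(1-\eta(N))$, and $\omega^N$ is obtained from $\omega$ by replacing $\eta(N)$ by $1-\eta(N)$ and $n_+$ by $n_++1$ if $\eta(N)=1$ and by $n_+-1$ if $\eta(N)=0$; $c_1$ and $\omega^1$ are defined in the same way from $\eta(1)$ and $n_-$. Let $\alpha>0$ and $M=\lfloor N^{1+\alpha}\rfloor$. Let $v_{0,\pm}\in[0,1]$ and let $u_0:(0,1]\to[0,1]$ be continuous on $(0,1)$. For every $N$ let an initial law on $\Omega$ be given such that, at time $0$,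 $n_\pm/M\to v_{0,\pm}$ in probability as $N\to\infty$ and $\mathbf E^N[\eta(x,0)]=u_0(x/N)$ for all $x\in\{1,\dots,N\}$; $\mathbf E^N$ denotes the expectation for the process with this initial law. Write $$K_N(x,y;s)=\mathbf E^N[\eta(x,s)\eta(y,s)]-\mathbf E^N[\eta(x,s)]\,\mathbf E^N[\eta(y,s)].$$ Let $\alpha'\in[0,\alpha)$ and $t>0$. Then: (i) for any distinct sites $x_1,x_2\in\{1,2,\dots\}$ (not depending on $N$), $\lim_{N\to\infty}|K_N(x_1,x_2;N^{2+\alpha'}t)|=0$; (ii) if $\alpha'>0$, or if the initial laws satisfy $\lim_{N\to\infty}\sup_{1\le x\ne y\le N}|K_N(x,y;0)|=0$ (for instance, if the $\eta(x,0)$ are independent), then the limit holds also for sites that depend on $N$, uniformly: $\lim_{N\to\infty}\sup_{1\le x\ne y\le N}|K_N(x,y;N^{2+\alpha'}t)|=0$. -/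

import Mathlib

open Filter Topology

noncomputable section

namespace ReservoirSSEP

/-- The sites of the channel `{1, …, N}`. -/
abbrev Site (N : ℕ) : Type := {x : ℕ // x ∈ Finset.Icc 1 N}

/-- The state space `{0,1}^{1,…,N} × {0,…,M} × {0,…,M}`; an element is `(η, n₋, n₊)`. -/
abbrev Config (N M : ℕ) : Type := (Site N → Bool) × Fin (M + 1) × Fin (M + 1)

variable {N M : ℕ}

/-- Occupation number (0 or 1) as a real number. -/
def occ (b : Bool) : ℝ := if b then 1 else 0

/-- The occupation variable `η(x)` of the site `x` (and `0` if `x` is not in `{1, …, N}`). -/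
def eta (x : ℕ) (ω : Config N M) : ℝ :=
  if h : x ∈ Finset.Icc 1 N then occ (ω.1 ⟨x, h⟩) else 0

/-- The density `n₋ / M` of the left reservoir. -/
def leftDensity (ω : Config N M) : ℝ := (ω.2.1 : ℕ) / (M : ℝ)

/-- The density `n₊ / M` of the right reservoir. -/
def rightDensity (ω : Config N M) : ℝ := (ω.2.2 : ℕ) / (M : ℝ)

/-- The configuration in which the occupations of the sites `x` and `y` are exchanged. -/
def exchange (ω : Config N M) (x y : Site N) : Config N M :=
  (ω.1 ∘ Equiv.swap x y, ω.2)

/-- Number of particles of a reservoir with `n` particles after an exchange with a channel site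
whose occupation before the exchange is `b`: a particle enters the reservoir if `b = 1` and leaves
it if `b = 0`. The truncations (at `n = M`, `b = 1`, and at `n = 0`, `b = 0`) are only met for moves
of rate zero. -/
def reservoirMove (b : Bool) (n : Fin (M + 1)) : Fin (M + 1) :=
  if b then ⟨min ((n : ℕ) + 1) M, by omega⟩ else ⟨(n : ℕ) - 1, by omega⟩

/-- Exchange between the channel site `x` and the left reservoir. -/
def leftMove (ω : Config N M) (x : Site N) : Config N M :=
  (Function.update ω.1 x (!(ω.1 x)), reservoirMove (ω.1 x) ω.2.1, ω.2.2)

/-- Exchange between the channel site `x` and the right reservoir. -/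
def rightMove (ω : Config N M) (x : Site N) : Config N M :=
  (Function.update ω.1 x (!(ω.1 x)), ω.2.1, reservoirMove (ω.1 x) ω.2.2)

/-- The rate of the exchange between a site with occupation `e` and a reservoir of density `d`. -/
def boundaryRate (e d : ℝ) : ℝ := 1 / 2 * (1 - d) * e + 1 / 2 * d * (1 - e)

/-- The generator: neighbouring sites of the channel exchange their occupations at rate `1/2`, and
the sites `1` and `N` exchange particles with the left and with the right reservoir. -/
def genFun (f : Config N M → ℝ) (ω : Config N M) : ℝ :=
  (1 / 2) * (∑ x : Site N, ∑ y : Site N,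
      if (y : ℕ) = (x : ℕ) + 1 then f (exchange ω x y) - f ω else 0)
  + (∑ x : Site N, if (x : ℕ) = N then
      boundaryRate (occ (ω.1 x)) (rightDensity ω) * (f (rightMove ω x) - f ω) else 0)
  + (∑ x : Site N, if (x : ℕ) = 1 then
      boundaryRate (occ (ω.1 x)) (leftDensity ω) * (f (leftMove ω x) - f ω) else 0)

/-- The generator as a linear operator on the functions on the (finite) state space. -/
def gen (N M : ℕ) : (Config N M → ℝ) →ₗ[ℝ] (Config N M → ℝ) where
  toFun := genFun
  map_add' f g := by
    funext ω
    simp only [genFun, Pi.add_apply, Finset.mul_sum]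
    have e1 : ∀ a b c d : ℝ, a + b - (c + d) = (a - c) + (b - d) := by intros; ring
    simp only [e1, mul_add, ite_add_zero, Finset.sum_add_distrib]
    ring
  map_smul' c f := by
    funext ω
    simp only [genFun, Pi.smul_apply, smul_eq_mul, RingHom.id_apply]
    have e1 : ∀ a b : ℝ, c * a - c * b = c * (a - b) := by intros; ring
    have e2 : ∀ a b : ℝ, a * (c * b) = c * (a * b) := by intros; ring
    have e3 : ∀ (p : Prop) [Decidable p] (a : ℝ), (if p then c * a else 0) = c * (if p then a else 0) := by
      intro p _ a; split_ifs <;> simp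
    simp only [e1, e2, e3, ← Finset.mul_sum]
    ring

/-- The Markov semigroup `exp (s L)` at time `s`: `(semigroup N M s f) ω` is the expectation of
`f` at time `s` for the process with generator `L` started at `ω`. -/
def semigroup (N M : ℕ) (s : ℝ) : (Config N M → ℝ) →L[ℝ] (Config N M → ℝ) :=
  NormedSpace.exp (s • LinearMap.toContinuousLinearMap (gen N M))

/-- The expectation of `f` at time `s` for the process with generator `L` and initial law `μ`
(a probability vector on the state space). -/
def expect (μ : Config N M → ℝ) (s : ℝ) (f : Config N M → ℝ) : ℝ :=
  ∑ ω, μ ω * semigroup N M s f ω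

/-- The two-point correlation `E[η(x) η(y)] - E[η(x)] E[η(y)]` at time `s`. -/
def correlation (μ : Config N M → ℝ) (s : ℝ) (x y : ℕ) : ℝ :=
  expect μ s (fun ω => eta x ω * eta y ω) - expect μ s (eta x) * expect μ s (eta y)

open Classical in
/-- The probability of the event `A` under the probability vector `μ`. -/
def prob (μ : Config N M → ℝ) (A : Config N M → Prop) : ℝ := ∑ ω, if A ω then μ ω else 0

/-- The size of a reservoir: the integer part of `N ^ (1 + α)`. -/
def resSize (α : ℝ) (N : ℕ) : ℕ := ⌊(N : ℝ) ^ (1 + α)⌋₊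

/-- The assumption on the initial laws `μ N`: the densities of the reservoirs converge
in probability to `vm` and `vp`, and the mean occupation of the site `x` is `u₀ (x / N)`. -/
structure InitialAssumption (α : ℝ) (u₀ : ℝ → ℝ) (vm vp : ℝ)
    (μ : (N : ℕ) → Config N (resSize α N) → ℝ) : Prop where
  isProb : ∀ N, μ N ∈ stdSimplex ℝ (Config N (resSize α N))
  left_tendsto : ∀ δ > 0,
    Tendsto (fun N => prob (μ N) (fun ω => δ < |leftDensity ω - vm|)) atTop (𝓝 0)
  right_tendsto : ∀ δ > 0,
    Tendsto (fun N => prob (μ N) (fun ω => δ < |rightDensity ω - vp|)) atTop (𝓝 0)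
  profile : ∀ N, ∀ x ∈ Finset.Icc 1 N, ∑ ω, μ N ω * eta x ω = u₀ ((x : ℝ) / N)

/-- The correlations at the times `s N`, for the initial laws `μ N`, of pairs of distinct sites of
the channel tend to `0` as `N → ∞`, uniformly in the pair. -/
def UniformlyDecorrelated (α : ℝ) (μ : (N : ℕ) → Config N (resSize α N) → ℝ) (s : ℕ → ℝ) : Prop :=
  ∀ ε > 0, ∀ᶠ N in atTop, ∀ x ∈ Finset.Icc 1 N, ∀ y ∈ Finset.Icc 1 N, x ≠ y →
    |correlation (μ N) (s N) x y| < ε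

end ReservoirSSEP

end

/-! Unfold each reservoir into `M` sites, all joined to the adjacent end of the channel at rate
`1/(2M)`. The given chain is symmetric exclusion on this graph, seen through the particle numbers of
the reservoirs. Hence the one- and two-point functions satisfy closed equations (`gen_density`,
`gen_density₂`): the mean density `U` solves the heat equation of one walker, and the correlation
`K` of two distinct vertices solves `K' = L₂ K - c(a,b) (U a - U b)^2`, where `L₂` generates two
walkers with exclusion (`hasDerivAt_pairCorrelation`). By Duhamel's formula `K` at time `s` is the
evolved initial correlation minus the evolved sources.

Sources. Exclusion makes the walkers negatively dependent, so a pair sits on a given edge with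
probability at most `4 q^2`, where `q` bounds the transition probabilities of one walker
(`flow_pairGen_source_le`). A Nash inequality gives `q^2 = O(1/(1+t) + 1/M^2)`
(`flow_single_site_le`). The Dirichlet energy of `U` has integral `O(N + s/N)` up to time `s`, as
one sees by comparing `U` with the linear profile between the reservoirs. The energy also decreases,
so it is `O(N/s + 1/N)` after time `s/2`. Using the decay of `q` before `s/2` and that of the energy
after it gives `sourceBound`, which vanishes for `s = N^(2+α') t`.

Initial correlations. Pairs that involve a reservoir are almost uncorrelated, because the reservoir
densities concentrate. Pairs inside the channel matter only if walkers are in the channel at time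
`s`; from `x` this has probability at most `N/M + x(N+1-x)/s` (`flow_channel_le`), the second term
coming from the mean exit time. It vanishes for fixed `x`, and uniformly when `s` is much larger
than `N^2`. On the scale `N^2` uniformity requires decorrelated initial laws, whence the two
alternatives in (ii). -/

noncomputable section

namespace ReservoirSSEP

/-! ### Positivity and comparison for finite-dimensional semigroups -/

section Flow

variable {ι : Type*} [Fintype ι]

/-- The semigroup `exp (t A)` generated by a linear operator on the functions on a finite type. -/
def flow (A : (ι → ℝ) →ₗ[ℝ] (ι → ℝ)) (t : ℝ) : (ι → ℝ) →L[ℝ] (ι → ℝ) :=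
  NormedSpace.exp (t • LinearMap.toContinuousLinearMap A)

lemma flow_zero (A : (ι → ℝ) →ₗ[ℝ] (ι → ℝ)) : flow A 0 = 1 := by
  simp [flow]

lemma hasDerivAt_flow (A : (ι → ℝ) →ₗ[ℝ] (ι → ℝ)) (t : ℝ) :
    HasDerivAt (flow A) (flow A t * LinearMap.toContinuousLinearMap A) t :=
  hasDerivAt_exp_smul_const (𝕂 := ℝ) (LinearMap.toContinuousLinearMap A) t

lemma flow_commute (A : (ι → ℝ) →ₗ[ℝ] (ι → ℝ)) (t : ℝ) (f : ι → ℝ) :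
    flow A t (A f) = A (flow A t f) := by
  have h : Commute (LinearMap.toContinuousLinearMap A) (flow A t) :=
    ((Commute.refl (LinearMap.toContinuousLinearMap A)).smul_right t).exp_right
  have := congrArg (fun T : (ι → ℝ) →L[ℝ] (ι → ℝ) => T f) h.eq
  exact this.symm

lemma hasDerivAt_flow_apply (A : (ι → ℝ) →ₗ[ℝ] (ι → ℝ)) (f : ι → ℝ) (t : ℝ) :
    HasDerivAt (fun s => flow A s f) (A (flow A t f)) t := by
  have h := (hasDerivAt_flow A t).clm_apply (hasDerivAt_const t f)
  rw [← flow_commute]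
  simpa using h

/-- Because `exp (tA) = e^(-tb) exp (t(A + b))` and the exponential series has nonnegative
coefficients for `t ≥ 0`, its partial sums stay in a convex cone preserved by `A + b`, and
closedness covers the limit. The cone of nonnegative functions yields positivity; a subspace with `b
= 0` yields invariance. -/
lemma flow_mem_of_shift (A : (ι → ℝ) →ₗ[ℝ] (ι → ℝ)) (C : Set (ι → ℝ)) (hC : IsClosed C)
    (hzero : (0 : ι → ℝ) ∈ C) (hadd : ∀ f ∈ C, ∀ g ∈ C, f + g ∈ C)
    (hsmul : ∀ a : ℝ, 0 ≤ a → ∀ f ∈ C, a • f ∈ C) (b : ℝ) (hA : ∀ f ∈ C, A f + b • f ∈ C)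
    {t : ℝ} (ht : 0 ≤ t) {f : ι → ℝ} (hf : f ∈ C) : flow A t f ∈ C := by
  set T := LinearMap.toContinuousLinearMap A with hT
  set B : (ι → ℝ) →L[ℝ] (ι → ℝ) := T + b • 1 with hB
  have hBC : ∀ f ∈ C, B f ∈ C := fun f hf => by simpa [hB, hT] using hA f hf
  have hpow : ∀ n : ℕ, (B ^ n) f ∈ C := by
    intro n
    induction n with
    | zero => simpa using hf
    | succ n ih => rw [pow_succ']; exact hBC _ ih
  have hsum : HasSum (fun n : ℕ => ((n.factorial : ℝ)⁻¹ • (t • B) ^ n) f)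
      (NormedSpace.exp (t • B) f) := by
    have h := NormedSpace.exp_series_hasSum_exp' (𝕂 := ℝ) (t • B)
    have h2 := h.mapL (ContinuousLinearMap.apply ℝ (ι → ℝ) f)
    simpa only [ContinuousLinearMap.apply_apply] using h2
  have hexp : NormedSpace.exp (t • B) f ∈ C := by
    refine hC.mem_of_tendsto hsum (Eventually.of_forall fun s => ?_)
    refine Finset.sum_induction _ (· ∈ C) (fun a b ha hb => hadd a ha b hb) hzero ?_
    intro n _
    rw [smul_pow, smul_smul]
    exact hsmul _ (by positivity) _ (hpow n)
  have hsplit : flow A t = Real.exp (-(t * b)) • NormedSpace.exp (t • B) := by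
    have h1 : t • T = algebraMap ℝ ((ι → ℝ) →L[ℝ] (ι → ℝ)) (-(t * b)) + t • B := by
      rw [Algebra.algebraMap_eq_smul_one, hB, smul_add, smul_smul, neg_smul]; abel
    let _ : NormedAlgebra ℚ ((ι → ℝ) →L[ℝ] (ι → ℝ)) := NormedAlgebra.restrictScalars ℚ ℝ _
    rw [flow, ← hT, h1, NormedSpace.exp_add_of_commute (Algebra.commutes _ _),
      ← NormedSpace.algebraMap_exp_comm, ← Real.exp_eq_exp_ℝ, ← Algebra.smul_def]
  rw [hsplit]
  exact hsmul _ (Real.exp_pos _).le _ hexp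

/-- Off-diagonal entries of `A` are nonnegative, up to a shift of the diagonal. -/
def IsMetzler (A : (ι → ℝ) →ₗ[ℝ] (ι → ℝ)) : Prop :=
  ∃ b : ℝ, ∀ f : ι → ℝ, 0 ≤ f → 0 ≤ A f + b • f

lemma flow_nonneg {A : (ι → ℝ) →ₗ[ℝ] (ι → ℝ)} (hA : IsMetzler A) {t : ℝ} (ht : 0 ≤ t)
    {f : ι → ℝ} (hf : 0 ≤ f) : 0 ≤ flow A t f := by
  obtain ⟨b, hb⟩ := hA
  exact flow_mem_of_shift A (Set.Ici 0) isClosed_Ici (Set.mem_Ici.2 le_rfl)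
    (fun f hf g hg => add_nonneg (Set.mem_Ici.1 hf) (Set.mem_Ici.1 hg))
    (fun a ha f hf => smul_nonneg ha (Set.mem_Ici.1 hf)) b hb ht hf

lemma flow_mono {A : (ι → ℝ) →ₗ[ℝ] (ι → ℝ)} (hA : IsMetzler A) {t : ℝ} (ht : 0 ≤ t)
    {f g : ι → ℝ} (hfg : f ≤ g) : flow A t f ≤ flow A t g := by
  have h := flow_nonneg hA ht (sub_nonneg.2 hfg)
  rwa [map_sub, sub_nonneg] at h

lemma flow_mem_submodule {A : (ι → ℝ) →ₗ[ℝ] (ι → ℝ)} (S : Submodule ℝ (ι → ℝ))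
    (hA : ∀ f ∈ S, A f ∈ S) {t : ℝ} (ht : 0 ≤ t) {f : ι → ℝ} (hf : f ∈ S) : flow A t f ∈ S :=
  flow_mem_of_shift A S S.closed_of_finiteDimensional S.zero_mem
    (fun _ hf _ hg => S.add_mem hf hg) (fun a _ _ hf => S.smul_mem a hf) 0
    (fun f hf => by simpa using hA f hf) ht hf

lemma monotoneOn_of_hasDerivAt_nonneg {φ φ' : ℝ → ℝ} {a b : ℝ}
    (hφ : ∀ r ∈ Set.Icc a b, HasDerivAt φ (φ' r) r) (h : ∀ r ∈ Set.Icc a b, 0 ≤ φ' r) :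
    MonotoneOn φ (Set.Icc a b) := by
  refine monotoneOn_of_deriv_nonneg (convex_Icc a b)
    (fun r hr => (hφ r hr).continuousAt.continuousWithinAt) ?_ ?_
  · exact fun r hr => (hφ r (interior_subset hr)).differentiableAt.differentiableWithinAt
  · intro r hr
    rw [(hφ r (interior_subset hr)).deriv]
    exact h r (interior_subset hr)

/-- Differentiation of the interpolation `r ↦ exp ((t - r) A) (u r)`. -/
lemma hasDerivAt_flow_sub_apply (A : (ι → ℝ) →ₗ[ℝ] (ι → ℝ)) {u : ℝ → ι → ℝ} {u' : ι → ℝ}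
    (t r : ℝ) (hu : HasDerivAt u u' r) :
    HasDerivAt (fun s => flow A (t - s) (u s)) (flow A (t - r) (u' - A (u r))) r := by
  have h1 : HasDerivAt (fun s => flow A (t - s))
      ((-1 : ℝ) • (flow A (t - r) * LinearMap.toContinuousLinearMap A)) r :=
    (hasDerivAt_flow A (t - r)).scomp r ((hasDerivAt_id r).const_sub t)
  have h2 := h1.clm_apply hu
  have e : flow A (t - r) (u' - A (u r)) =
      ((-1 : ℝ) • (flow A (t - r) * LinearMap.toContinuousLinearMap A)) (u r)
        + flow A (t - r) u' := by
    simp [sub_eq_neg_add]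
  rw [e]
  exact h2

/-- The interpolation `r ↦ exp ((t - r) A) (u r)` has derivative `exp ((t - r) A) (u' - A u)`, which
is nonpositive by positivity of the semigroup; its two endpoints are the two sides. -/
lemma le_flow_of_deriv_le {A : (ι → ℝ) →ₗ[ℝ] (ι → ℝ)} (hA : IsMetzler A) {u u' : ℝ → ι → ℝ}
    {t : ℝ} (ht : 0 ≤ t) (hu : ∀ r ∈ Set.Icc 0 t, HasDerivAt u (u' r) r)
    (h : ∀ r ∈ Set.Icc 0 t, u' r ≤ A (u r)) : u t ≤ flow A t (u 0) := by
  intro i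
  have hm : MonotoneOn (fun r => -(flow A (t - r) (u r) i)) (Set.Icc 0 t) := by
    refine monotoneOn_of_hasDerivAt_nonneg
      (φ' := fun r => -(flow A (t - r) (u' r - A (u r)) i)) (fun r hr => ?_) (fun r hr => ?_)
    · exact ((hasDerivAt_pi.1 (hasDerivAt_flow_sub_apply A t r (hu r hr))) i).neg
    · have := flow_nonneg hA (sub_nonneg.2 hr.2) (sub_nonneg.2 (h r hr)) i
      have e : A (u r) - u' r = -(u' r - A (u r)) := by abel
      rw [e, map_neg] at this
      simpa using this
  have := hm ⟨le_rfl, ht⟩ ⟨ht, le_rfl⟩ ht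
  simp only [sub_self, flow_zero, sub_zero] at this
  simpa using this

lemma flow_le_of_le_deriv {A : (ι → ℝ) →ₗ[ℝ] (ι → ℝ)} (hA : IsMetzler A) {u u' : ℝ → ι → ℝ}
    {t : ℝ} (ht : 0 ≤ t) (hu : ∀ r ∈ Set.Icc 0 t, HasDerivAt u (u' r) r)
    (h : ∀ r ∈ Set.Icc 0 t, A (u r) ≤ u' r) : flow A t (u 0) ≤ u t := by
  have := le_flow_of_deriv_le hA (u := fun r => -u r) (u' := fun r => -u' r) ht
    (fun r hr => (hu r hr).neg) (fun r hr => by rw [map_neg]; exact neg_le_neg (h r hr))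
  rw [map_neg] at this
  exact neg_le_neg_iff.1 this

lemma eq_flow_of_deriv_eq {A : (ι → ℝ) →ₗ[ℝ] (ι → ℝ)} (hA : IsMetzler A) {u : ℝ → ι → ℝ}
    {t : ℝ} (ht : 0 ≤ t) (hu : ∀ r ∈ Set.Icc 0 t, HasDerivAt u (A (u r)) r) :
    u t = flow A t (u 0) :=
  le_antisymm (le_flow_of_deriv_le hA ht hu fun _ _ => le_rfl)
    (flow_le_of_le_deriv hA ht hu fun _ _ => le_rfl)

end Flow

/-! ### Functions of pairs of distinct points -/

section OffDiag

variable {V : Type*} [DecidableEq V]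

/-- The function of a pair given by `F` off the diagonal and `0` on the diagonal. -/
def offDiag (F : V → V → ℝ) (p : V × V) : ℝ := if p.1 = p.2 then 0 else F p.1 p.2

lemma offDiag_of_ne (F : V → V → ℝ) {x y : V} (h : x ≠ y) : offDiag F (x, y) = F x y := if_neg h

lemma offDiag_self (F : V → V → ℝ) (x : V) : offDiag F (x, x) = 0 := if_pos rfl

lemma hasDerivAt_offDiag {F : ℝ → V → V → ℝ} {F' : V → V → ℝ} {r : ℝ}
    (h : ∀ x y, x ≠ y → HasDerivAt (fun r => F r x y) (F' x y) r) :
    HasDerivAt (fun r => offDiag (F r)) (offDiag F') r := by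
  rw [hasDerivAt_pi]
  rintro ⟨x, y⟩
  by_cases hxy : x = y
  · subst hxy
    simpa only [offDiag_self] using hasDerivAt_const r (0 : ℝ)
  · simpa only [offDiag_of_ne _ hxy] using h x y hxy

end OffDiag

/-! ### Reversible walks: Dirichlet form, self-adjointness, energy -/

section Walks

variable {V : Type*} [Fintype V]

/-- The generator of the random walk with jump rates `c x y`. -/
def walkGen (c : V → V → ℝ) : (V → ℝ) →ₗ[ℝ] (V → ℝ) where
  toFun f x := ∑ y, c x y * (f y - f x)
  map_add' f g := by
    funext x
    simp only [Pi.add_apply, ← Finset.sum_add_distrib]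
    exact Finset.sum_congr rfl fun y _ => by ring
  map_smul' a f := by
    funext x
    simp only [Pi.smul_apply, smul_eq_mul, RingHom.id_apply, Finset.mul_sum]
    exact Finset.sum_congr rfl fun y _ => by ring

lemma walkGen_apply (c : V → V → ℝ) (f : V → ℝ) (x : V) :
    walkGen c f x = ∑ y, c x y * (f y - f x) := rfl

/-- The Dirichlet form of the random walk with jump rates `c x y`. -/
def dirichlet (c : V → V → ℝ) (f g : V → ℝ) : ℝ :=
  ∑ x, ∑ y, c x y * ((f x - f y) * (g x - g y))

lemma dirichlet_comm (c : V → V → ℝ) (f g : V → ℝ) : dirichlet c f g = dirichlet c g f := by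
  simp only [dirichlet, mul_comm (f _ - f _)]

lemma dirichlet_self_nonneg {c : V → V → ℝ} (hc : ∀ x y, 0 ≤ c x y) (f : V → ℝ) :
    0 ≤ dirichlet c f f :=
  Finset.sum_nonneg fun x _ => Finset.sum_nonneg fun y _ =>
    mul_nonneg (hc x y) (mul_self_nonneg _)

/-- Summation by parts. The form runs over ordered pairs and so counts every edge twice, which is
the factor `2`. -/
lemma dirichlet_eq {c : V → V → ℝ} (hs : ∀ x y, c x y = c y x) (f g : V → ℝ) :
    dirichlet c f g = -2 * ∑ x, g x * walkGen c f x := by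
  have h1 : dirichlet c f g = ∑ x, ∑ y, c x y * (f x - f y) * g x
      - ∑ x, ∑ y, c x y * (f x - f y) * g y := by
    simp only [dirichlet, ← Finset.sum_sub_distrib]
    exact Finset.sum_congr rfl fun x _ => Finset.sum_congr rfl fun y _ => by ring
  have h2 : ∑ x, ∑ y, c x y * (f x - f y) * g y = - ∑ x, ∑ y, c x y * (f x - f y) * g x := by
    rw [Finset.sum_comm]
    simp only [← Finset.sum_neg_distrib]
    exact Finset.sum_congr rfl fun x _ => Finset.sum_congr rfl fun y _ => by rw [hs y x]; ring
  have h3 : ∑ x, g x * walkGen c f x = - ∑ x, ∑ y, c x y * (f x - f y) * g x := by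
    simp only [walkGen_apply, Finset.mul_sum, ← Finset.sum_neg_distrib]
    exact Finset.sum_congr rfl fun x _ => Finset.sum_congr rfl fun y _ => by ring
  rw [h1, h2, h3]; ring

lemma walkGen_selfAdjoint {c : V → V → ℝ} (hs : ∀ x y, c x y = c y x) (f g : V → ℝ) :
    ∑ x, walkGen c g x * f x = ∑ x, g x * walkGen c f x := by
  have h1 := dirichlet_eq hs f g
  have h2 := dirichlet_eq hs g f
  rw [dirichlet_comm] at h2
  have h3 : ∑ x, walkGen c g x * f x = ∑ x, f x * walkGen c g x :=
    Finset.sum_congr rfl fun x _ => mul_comm _ _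
  linarith

lemma isMetzler_walkGen {c : V → V → ℝ} (hc : ∀ x y, 0 ≤ c x y) : IsMetzler (walkGen c) := by
  refine ⟨∑ x, ∑ y, c x y, fun f hf x => ?_⟩
  have h1 : ∑ y, c x y ≤ ∑ x, ∑ y, c x y :=
    Finset.single_le_sum (f := fun x => ∑ y, c x y)
      (fun x _ => Finset.sum_nonneg fun y _ => hc x y) (Finset.mem_univ x)
  have h2 : 0 ≤ ∑ y, c x y * f y := Finset.sum_nonneg fun y _ => mul_nonneg (hc x y) (hf y)
  have h3 : walkGen c f x = ∑ y, c x y * f y - (∑ y, c x y) * f x := by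
    simp only [walkGen_apply, mul_sub, Finset.sum_sub_distrib, Finset.sum_mul]
  simp only [Pi.zero_apply, Pi.add_apply, Pi.smul_apply, smul_eq_mul, h3]
  nlinarith [mul_le_mul_of_nonneg_right h1 (hf x)]

/-- By self-adjointness the `r`-derivative of the left side vanishes. The choice `r = t` gives
symmetry of the semigroup; `r = t / 2` writes a transition probability as a scalar product of two
heat kernels at half the time. -/
lemma sum_flow_sub_mul_flow {c : V → V → ℝ} (hs : ∀ x y, c x y = c y x) (f g : V → ℝ)
    (t r : ℝ) : ∑ x, flow (walkGen c) (t - r) g x * flow (walkGen c) r f x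
      = ∑ x, flow (walkGen c) t g x * f x := by
  set φ : ℝ → ℝ := fun r => ∑ x, flow (walkGen c) (t - r) g x * flow (walkGen c) r f x with hφ
  have hd : ∀ r, HasDerivAt φ 0 r := by
    intro r
    have h : HasDerivAt φ (∑ x, ((flow (walkGen c) (t - r) (0 - walkGen c g) x)
        * flow (walkGen c) r f x
        + flow (walkGen c) (t - r) g x * walkGen c (flow (walkGen c) r f) x)) r := by
      refine HasDerivAt.fun_sum fun x _ => ?_
      exact (hasDerivAt_pi.1 (hasDerivAt_flow_sub_apply (walkGen c) t r
        (hasDerivAt_const r g)) x).mul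
        (hasDerivAt_pi.1 (hasDerivAt_flow_apply (walkGen c) f r) x)
    convert h using 1
    rw [Finset.sum_add_distrib, ← walkGen_selfAdjoint hs, ← Finset.sum_add_distrib]
    symm
    refine Finset.sum_eq_zero fun x _ => ?_
    rw [zero_sub, map_neg, flow_commute]
    simp
  have h0 := is_const_of_deriv_eq_zero (fun r => (hd r).differentiableAt) (fun r => (hd r).deriv) r 0
  simpa [hφ, flow_zero] using h0

lemma flow_walkGen_selfAdjoint {c : V → V → ℝ} (hs : ∀ x y, c x y = c y x) (f g : V → ℝ)
    (t : ℝ) : ∑ x, flow (walkGen c) t g x * f x = ∑ x, g x * flow (walkGen c) t f x := by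
  rw [← sum_flow_sub_mul_flow hs f g t t]
  simp [flow_zero]

lemma walkGen_const (c : V → V → ℝ) (a : ℝ) : walkGen c (fun _ => a) = 0 := by
  funext x; simp [walkGen_apply]

lemma flow_walkGen_const {c : V → V → ℝ} (hc : ∀ x y, 0 ≤ c x y) (a : ℝ) {t : ℝ} (ht : 0 ≤ t) :
    flow (walkGen c) t (fun _ => a) = fun _ => a :=
  (eq_flow_of_deriv_eq (isMetzler_walkGen hc) (u := fun _ _ => a) ht fun r _ => by
    rw [walkGen_const]; exact hasDerivAt_const r _).symm

lemma flow_walkGen_mem_Icc {c : V → V → ℝ} (hc : ∀ x y, 0 ≤ c x y) {f : V → ℝ}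
    (hf : ∀ x, f x ∈ Set.Icc (0 : ℝ) 1) {t : ℝ} (ht : 0 ≤ t) (x : V) :
    flow (walkGen c) t f x ∈ Set.Icc (0 : ℝ) 1 := by
  refine ⟨flow_nonneg (isMetzler_walkGen hc) ht (fun x => (hf x).1) x, ?_⟩
  have h := flow_mono (isMetzler_walkGen hc) ht (f := f) (g := fun _ => 1) (fun x => (hf x).2) x
  rwa [flow_walkGen_const hc 1 ht] at h

lemma sum_flow_walkGen {c : V → V → ℝ} (hc : ∀ x y, 0 ≤ c x y) (hs : ∀ x y, c x y = c y x)
    (f : V → ℝ) {t : ℝ} (ht : 0 ≤ t) : ∑ x, flow (walkGen c) t f x = ∑ x, f x := by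
  have h := flow_walkGen_selfAdjoint hs f (fun _ => 1) t
  rw [flow_walkGen_const hc 1 ht] at h
  simpa using h.symm

/-- The reference profile `l` is constant in time: it is `0` for the heat kernel, and linear between
the reservoirs for the mean density. -/
lemma hasDerivAt_sum_sq_sub {c : V → V → ℝ} (hs : ∀ x y, c x y = c y x) {u : ℝ → V → ℝ} {r : ℝ}
    (hu : HasDerivAt u (walkGen c (u r)) r) (l : V → ℝ) :
    HasDerivAt (fun r => ∑ x, (u r x - l x) ^ 2)
      (- dirichlet c (u r) (fun x => u r x - l x)) r := by
  have h : HasDerivAt (fun r => ∑ x, (u r x - l x) ^ 2)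
      (∑ x, ((2 : ℕ) : ℝ) * (u r x - l x) ^ (2 - 1) * walkGen c (u r) x) r :=
    HasDerivAt.fun_sum fun x _ => ((hasDerivAt_pi.1 hu x).sub_const (l x)).pow 2
  convert h using 1
  rw [dirichlet_eq hs, Finset.mul_sum, ← Finset.sum_neg_distrib]
  exact Finset.sum_congr rfl fun x _ => by push_cast; ring

/-- The sign is what counts: for nonnegative time increments the energy decreases, so a bound on its
time integral bounds its later values. -/
lemma hasDerivAt_dirichlet_self {c : V → V → ℝ} (hs : ∀ x y, c x y = c y x) {u : ℝ → V → ℝ}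
    {r : ℝ} (hu : HasDerivAt u (walkGen c (u r)) r) :
    HasDerivAt (fun r => dirichlet c (u r) (u r)) (-4 * ∑ x, walkGen c (u r) x ^ 2) r := by
  have h : HasDerivAt (fun r => dirichlet c (u r) (u r))
      (∑ x, ∑ y, c x y * ((walkGen c (u r) x - walkGen c (u r) y) * (u r x - u r y)
        + (u r x - u r y) * (walkGen c (u r) x - walkGen c (u r) y))) r := by
    refine HasDerivAt.fun_sum fun x _ => HasDerivAt.fun_sum fun y _ => ?_
    have := (hasDerivAt_pi.1 hu x).sub (hasDerivAt_pi.1 hu y)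
    exact (this.mul this).const_mul (c x y)
  convert h using 1
  have e : ∑ x, ∑ y, c x y * ((walkGen c (u r) x - walkGen c (u r) y) * (u r x - u r y)
        + (u r x - u r y) * (walkGen c (u r) x - walkGen c (u r) y))
      = 2 * dirichlet c (u r) (walkGen c (u r)) := by
    simp only [dirichlet, Finset.mul_sum]
    exact Finset.sum_congr rfl fun x _ => Finset.sum_congr rfl fun y _ => by ring
  rw [e, dirichlet_eq hs, ← mul_assoc]
  congr 1
  · norm_num
  · exact Finset.sum_congr rfl fun x _ => by ring

/-! ### Two walkers with exclusion -/

variable [DecidableEq V]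

/-- The generator of two walkers with jump rates `c x y` and exclusion. The pairs on the diagonal
are not reached from the other ones; they are absorbing here. -/
def pairGen (c : V → V → ℝ) : (V × V → ℝ) →ₗ[ℝ] (V × V → ℝ) where
  toFun F p := if p.1 = p.2 then 0 else
    ∑ w, (if w = p.2 then 0 else c p.1 w * (F (w, p.2) - F p))
      + ∑ w, (if w = p.1 then 0 else c p.2 w * (F (p.1, w) - F p))
  map_add' F G := by
    funext p
    simp only [Pi.add_apply]
    split_ifs with h
    · simp
    · rw [add_add_add_comm]
      congr 1
      all_goals
        rw [← Finset.sum_add_distrib]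
        exact Finset.sum_congr rfl fun w _ => by split_ifs <;> ring
  map_smul' a F := by
    funext p
    simp only [Pi.smul_apply, smul_eq_mul, RingHom.id_apply]
    split_ifs with h
    · simp
    · rw [mul_add]
      simp only [Finset.mul_sum]
      congr 1 <;> exact Finset.sum_congr rfl fun w _ => by split_ifs <;> ring

lemma pairGen_apply_of_ne (c : V → V → ℝ) (F : V × V → ℝ) {x y : V} (h : x ≠ y) :
    pairGen c F (x, y) = ∑ w, (if w = y then 0 else c x w * (F (w, y) - F (x, y)))
      + ∑ w, (if w = x then 0 else c y w * (F (x, w) - F (x, y))) :=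
  if_neg h

lemma pairGen_apply_self (c : V → V → ℝ) (F : V × V → ℝ) (x : V) :
    pairGen c F (x, x) = 0 := if_pos rfl

lemma sum_ite_eq_zero_else (g : V → ℝ) (a : V) :
    ∑ w, (if w = a then 0 else g w) = ∑ w, g w - g a := by
  have h : ∀ w, (if w = a then 0 else g w) = g w - (if w = a then g w else 0) := by
    intro w; split_ifs <;> simp
  simp [h, Finset.sum_sub_distrib]

/-- Free walkers minus the suppressed jumps of one walker onto the other. The diagonal values of `F`
enter the free sums and are subtracted again, so they are immaterial. -/
lemma pairGen_offDiag_apply (c : V → V → ℝ) (F : V → V → ℝ) {x y : V} (h : x ≠ y) :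
    pairGen c (offDiag F) (x, y) =
      ∑ w, c x w * (F w y - F x y) - c x y * (F y y - F x y)
      + (∑ w, c y w * (F x w - F x y) - c y x * (F x x - F x y)) := by
  rw [pairGen_apply_of_ne c _ h, ← sum_ite_eq_zero_else (fun w => c x w * (F w y - F x y)),
    ← sum_ite_eq_zero_else (fun w => c y w * (F x w - F x y)), offDiag_of_ne _ h]
  congr 1 <;> refine Finset.sum_congr rfl fun w _ => ?_
  · split_ifs with hw
    · rfl
    · rw [offDiag_of_ne _ hw]
  · split_ifs with hw
    · rfl
    · rw [offDiag_of_ne _ (Ne.symm hw)]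

/-- The suppressed jumps would change `v a * v b` by `v b ^ 2 - v a * v b` and by `v a ^ 2 - v a * v
b`, which add up to `(v a - v b) ^ 2`. This identity gives both the negative dependence and the
source term in the equation for the correlations. -/
lemma pairGen_offDiag_mul {c : V → V → ℝ} (hs : ∀ x y, c x y = c y x) (v : V → ℝ) :
    pairGen c (offDiag fun a b => v a * v b) = offDiag fun a b =>
      walkGen c v a * v b + v a * walkGen c v b - c a b * (v a - v b) ^ 2 := by
  funext ⟨x, y⟩
  by_cases h : x = y
  · subst h; rw [pairGen_apply_self, offDiag_self]
  · rw [pairGen_offDiag_apply c _ h, offDiag_of_ne _ h, walkGen_apply, walkGen_apply,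
      Finset.sum_mul, Finset.mul_sum, hs y x]
    have e1 : ∑ w, c x w * (v w * v y - v x * v y) = ∑ w, c x w * (v w - v x) * v y :=
      Finset.sum_congr rfl fun w _ => by ring
    have e2 : ∑ w, c y w * (v x * v w - v x * v y) = ∑ w, v x * (c y w * (v w - v y)) :=
      Finset.sum_congr rfl fun w _ => by ring
    rw [e1, e2]; ring

/-- For a sum the contributions of the two suppressed jumps cancel, so exclusion is invisible. -/
lemma pairGen_offDiag_add {c : V → V → ℝ} (hs : ∀ x y, c x y = c y x) (v : V → ℝ) :
    pairGen c (offDiag fun a b => v a + v b) = offDiag fun a b =>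
      walkGen c v a + walkGen c v b := by
  funext ⟨x, y⟩
  by_cases h : x = y
  · subst h; rw [pairGen_apply_self, offDiag_self]
  · rw [pairGen_offDiag_apply c _ h, offDiag_of_ne _ h, walkGen_apply, walkGen_apply, hs y x]
    simp only [add_sub_add_right_eq_sub, add_sub_add_left_eq_sub]
    ring

lemma pairGen_offDiag_const (c : V → V → ℝ) (a : ℝ) : pairGen c (offDiag fun _ _ => a) = 0 := by
  funext ⟨x, y⟩
  by_cases h : x = y
  · subst h; rw [pairGen_apply_self]; rfl
  · rw [pairGen_offDiag_apply c _ h]; simp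

lemma isMetzler_pairGen {c : V → V → ℝ} (hc : ∀ x y, 0 ≤ c x y) : IsMetzler (pairGen c) := by
  refine ⟨2 * ∑ x, ∑ y, c x y, fun F hF => ?_⟩
  have h1 : ∀ x, ∑ y, c x y ≤ ∑ x, ∑ y, c x y := fun x =>
    Finset.single_le_sum (f := fun x => ∑ y, c x y)
      (fun x _ => Finset.sum_nonneg fun y _ => hc x y) (Finset.mem_univ x)
  have h0 : 0 ≤ ∑ x, ∑ y, c x y := Finset.sum_nonneg fun x _ => Finset.sum_nonneg fun y _ => hc x y
  rintro ⟨x, y⟩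
  have hp : 0 ≤ F (x, y) := hF _
  simp only [Pi.zero_apply, Pi.add_apply, Pi.smul_apply, smul_eq_mul]
  by_cases h : x = y
  · subst h
    rw [pairGen_apply_self]
    positivity
  · rw [pairGen_apply_of_ne c _ h]
    have h2 : -((∑ w, c x w) * F (x, y)) ≤
        ∑ w, (if w = y then 0 else c x w * (F (w, y) - F (x, y))) := by
      rw [Finset.sum_mul, ← Finset.sum_neg_distrib]
      refine Finset.sum_le_sum fun w _ => ?_
      have := mul_nonneg (hc x w) hp
      have := mul_nonneg (hc x w) (hF (w, y))
      split_ifs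
      · linarith
      · rw [mul_sub]; linarith
    have h3 : -((∑ w, c y w) * F (x, y)) ≤
        ∑ w, (if w = x then 0 else c y w * (F (x, w) - F (x, y))) := by
      rw [Finset.sum_mul, ← Finset.sum_neg_distrib]
      refine Finset.sum_le_sum fun w _ => ?_
      have := mul_nonneg (hc y w) hp
      have := mul_nonneg (hc y w) (hF (x, w))
      split_ifs
      · linarith
      · rw [mul_sub]; linarith
    nlinarith [mul_le_mul_of_nonneg_right (h1 x) hp, mul_le_mul_of_nonneg_right (h1 y) hp]

/-- Negative dependence of two walkers with exclusion. -/
lemma flow_pairGen_mul_le {c : V → V → ℝ} (hc : ∀ x y, 0 ≤ c x y) (hs : ∀ x y, c x y = c y x)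
    (v : V → ℝ) {t : ℝ} (ht : 0 ≤ t) {x y : V} (hxy : x ≠ y) :
    flow (pairGen c) t (offDiag fun a b => v a * v b) (x, y)
      ≤ flow (walkGen c) t v x * flow (walkGen c) t v y := by
  have hd : ∀ r, HasDerivAt (fun r => flow (walkGen c) r v)
    (walkGen c (flow (walkGen c) r v)) r := fun r => hasDerivAt_flow_apply (walkGen c) v r
  have h := flow_le_of_le_deriv (isMetzler_pairGen hc)
    (u := fun r => offDiag fun a b => flow (walkGen c) r v a * flow (walkGen c) r v b)
    (u' := fun r => offDiag fun a b =>
      walkGen c (flow (walkGen c) r v) a * flow (walkGen c) r v b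
        + flow (walkGen c) r v a * walkGen c (flow (walkGen c) r v) b) ht
    (fun r _ => hasDerivAt_offDiag fun a b _ =>
      (hasDerivAt_pi.1 (hd r) a).mul (hasDerivAt_pi.1 (hd r) b))
    -- A product of two free solutions is a supersolution of the exclusion equation: the defect is
    -- the square in `pairGen_offDiag_mul`.
    (fun r _ => by
      rw [pairGen_offDiag_mul hs]
      intro p
      unfold offDiag
      split_ifs
      · exact le_rfl
      · have := mul_nonneg (hc p.1 p.2)
          (sq_nonneg (flow (walkGen c) r v p.1 - flow (walkGen c) r v p.2))
        linarith) (x, y)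
  rw [offDiag_of_ne _ hxy, flow_zero] at h
  exact h

lemma flow_pairGen_add {c : V → V → ℝ} (hc : ∀ x y, 0 ≤ c x y) (hs : ∀ x y, c x y = c y x)
    (v : V → ℝ) {t : ℝ} (ht : 0 ≤ t) :
    flow (pairGen c) t (offDiag fun a b => v a + v b)
      = offDiag fun a b => flow (walkGen c) t v a + flow (walkGen c) t v b := by
  have hd : ∀ r, HasDerivAt (fun r => flow (walkGen c) r v)
    (walkGen c (flow (walkGen c) r v)) r := fun r => hasDerivAt_flow_apply (walkGen c) v r
  have h := eq_flow_of_deriv_eq (isMetzler_pairGen hc)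
    (u := fun r => offDiag fun a b => flow (walkGen c) r v a + flow (walkGen c) r v b) ht
    (fun r _ => by
      rw [pairGen_offDiag_add hs]
      exact hasDerivAt_offDiag fun a b _ =>
        (hasDerivAt_pi.1 (hd r) a).add (hasDerivAt_pi.1 (hd r) b))
  rw [h, flow_zero]
  rfl

lemma flow_pairGen_const {c : V → V → ℝ} (hc : ∀ x y, 0 ≤ c x y) (a : ℝ) {t : ℝ} (ht : 0 ≤ t) :
    flow (pairGen c) t (offDiag fun _ _ => a) = offDiag fun _ _ => a :=
  (eq_flow_of_deriv_eq (isMetzler_pairGen hc) (u := fun _ => offDiag fun _ _ => a) ht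
    fun r _ => by rw [pairGen_offDiag_const]; exact hasDerivAt_const r _).symm

/-- The probability that a pair of walkers with exclusion sits at the two ends of an edge, weighted
with the energies of the edges, is bounded by means of the transition probabilities of a single
walker. -/
lemma flow_pairGen_source_le {c : V → V → ℝ} (hc : ∀ x y, 0 ≤ c x y) (hs : ∀ x y, c x y = c y x)
    (u : V → ℝ) {t q : ℝ} (ht : 0 ≤ t) {x y : V} (hxy : x ≠ y)
    (hx : ∀ a, flow (walkGen c) t (Pi.single a 1) x ≤ q)
    (hy : ∀ a, flow (walkGen c) t (Pi.single a 1) y ≤ q) :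
    flow (pairGen c) t (offDiag fun a b => c a b * (u a - u b) ^ 2) (x, y)
      ≤ 4 * q ^ 2 * dirichlet c u u := by
  -- `I a b` is the indicator of the set `{a, b}`. Its tensor square is `1` at the pair `(a, b)` and
  -- is nonnegative, so these products dominate the source edge by edge, and negative dependence
  -- applies to each of them.
  set I : V → V → V → ℝ := fun a b => Pi.single a 1 + Pi.single b 1 with hI
  have hsingle : ∀ a : V, 0 ≤ (Pi.single a 1 : V → ℝ) := fun a => by
    rw [Pi.single_nonneg]; exact zero_le_one
  have hI0 : ∀ a b, 0 ≤ I a b := fun a b => add_nonneg (hsingle a) (hsingle b)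
  have hw : ∀ a b, 0 ≤ c a b * (u a - u b) ^ 2 := fun a b => mul_nonneg (hc a b) (sq_nonneg _)
  have hoff : ∀ a b p, 0 ≤ offDiag (fun e f => I a b e * I a b f) p := by
    intro a b p
    unfold offDiag
    split_ifs
    · exact le_rfl
    · exact mul_nonneg (hI0 a b _) (hI0 a b _)
  have hle : (offDiag fun a b => c a b * (u a - u b) ^ 2) ≤
      ∑ a, ∑ b, (c a b * (u a - u b) ^ 2) • offDiag (fun e f => I a b e * I a b f) := by
    rintro ⟨a, b⟩
    by_cases hab : a = b
    · subst hab
      rw [offDiag_self]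
      simp only [Finset.sum_apply, Pi.smul_apply, smul_eq_mul]
      exact Finset.sum_nonneg fun a _ => Finset.sum_nonneg fun b _ =>
        mul_nonneg (hw a b) (hoff a b _)
    · rw [offDiag_of_ne _ hab]
      simp only [Finset.sum_apply, Pi.smul_apply, smul_eq_mul]
      have h1 : c a b * (u a - u b) ^ 2 = c a b * (u a - u b) ^ 2
          * offDiag (fun e f => I a b e * I a b f) (a, b) := by
        rw [offDiag_of_ne _ hab]
        simp [hI, hab, Ne.symm hab]
      rw [h1]
      refine le_trans (Finset.single_le_sum (f := fun b' => c a b' * (u a - u b') ^ 2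
          * offDiag (fun e f => I a b' e * I a b' f) (a, b))
          (fun b' _ => mul_nonneg (hw a b') (hoff a b' _)) (Finset.mem_univ b)) ?_
      exact Finset.single_le_sum (f := fun a' => ∑ b', c a' b' * (u a' - u b') ^ 2
          * offDiag (fun e f => I a' b' e * I a' b' f) (a, b))
          (fun a' _ => Finset.sum_nonneg fun b' _ => mul_nonneg (hw a' b') (hoff a' b' _))
          (Finset.mem_univ a)
  refine (flow_mono (isMetzler_pairGen hc) ht hle (x, y)).trans ?_
  simp only [map_sum, map_smul, Finset.sum_apply, Pi.smul_apply, smul_eq_mul]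
  rw [dirichlet, Finset.mul_sum]
  refine Finset.sum_le_sum fun a _ => ?_
  rw [Finset.mul_sum]
  refine Finset.sum_le_sum fun b _ => ?_
  have h2 := flow_pairGen_mul_le hc hs (I a b) ht hxy
  have hpos : ∀ a z, 0 ≤ flow (walkGen c) t (Pi.single a 1) z := fun a z =>
    flow_nonneg (isMetzler_walkGen hc) ht (hsingle a) z
  simp only [hI, map_add, Pi.add_apply] at h2
  have hq : 0 ≤ q := (hpos a x).trans (hx a)
  -- Each free walker is at `a` or `b` with probability at most `2 q`, whence the factor `4 q ^ 2`.
  have h3 : (flow (walkGen c) t (Pi.single a 1) x + flow (walkGen c) t (Pi.single b 1) x)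
      * (flow (walkGen c) t (Pi.single a 1) y + flow (walkGen c) t (Pi.single b 1) y)
      ≤ (q + q) * (q + q) :=
    mul_le_mul (add_le_add (hx a) (hx b)) (add_le_add (hy a) (hy b))
      (add_nonneg (hpos a y) (hpos b y)) (add_nonneg hq hq)
  have h4 := mul_le_mul_of_nonneg_left (h2.trans h3) (hw a b)
  calc _ ≤ _ := h4
    _ = _ := by ring

end Walks

/-! ### The graph with unfolded reservoirs and its Nash inequality -/

section Graph

/-- The sites of the channel together with `M` sites for each of the two reservoirs. -/
abbrev Vertex (N M : ℕ) : Type := Site N ⊕ (Fin M ⊕ Fin M)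

/-- The position of a vertex: `0` in the left reservoir and `N + 1` in the right one. -/
def pos {N M : ℕ} : Vertex N M → ℕ
  | Sum.inl x => x
  | Sum.inr (Sum.inl _) => 0
  | Sum.inr (Sum.inr _) => N + 1

/-- The weight of a vertex at position `k`. -/
def wt (N M k : ℕ) : ℝ := if k = 0 ∨ k = N + 1 then 1 / (M : ℝ) else 1

/-- The stirring rates: `1/2` between neighbouring sites and `1/(2M)` between a reservoir site and
the adjacent site of the channel. -/
def rate (N M : ℕ) (v w : Vertex N M) : ℝ :=
  if pos w = pos v + 1 ∨ pos v = pos w + 1 then wt N M (pos v) * wt N M (pos w) / 2 else 0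

variable {N M : ℕ}

lemma wt_nonneg (k : ℕ) : 0 ≤ wt N M k := by
  unfold wt; split_ifs <;> positivity

lemma rate_nonneg (v w : Vertex N M) : 0 ≤ rate N M v w := by
  unfold rate
  split_ifs
  · have := wt_nonneg (N := N) (M := M) (pos v)
    have := wt_nonneg (N := N) (M := M) (pos w)
    positivity
  · exact le_rfl

lemma rate_symm (v w : Vertex N M) : rate N M v w = rate N M w v := by
  unfold rate
  rw [mul_comm (wt N M (pos v))]
  exact if_congr or_comm rfl rfl

lemma wt_of_mem {k : ℕ} (hk : k ∈ Finset.Icc 1 N) : wt N M k = 1 := by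
  rw [Finset.mem_Icc] at hk
  exact if_neg (by omega)

lemma pos_le (v : Vertex N M) : pos v ≤ N + 1 := by
  rcases v with ⟨x, hx⟩ | i | i
  · have := (Finset.mem_Icc.1 hx).2
    simp only [pos]; omega
  · simp [pos]
  · simp [pos]

lemma sum_site (G : ℕ → ℝ) : ∑ x : Site N, G x = ∑ k ∈ Finset.range N, G (k + 1) := by
  rw [Finset.sum_coe_sort (Finset.Icc 1 N) G, Finset.range_eq_Ico, Finset.sum_Ico_add' G 0 N 1]
  rfl

/-- The `M` sites of a reservoir, each of weight `1 / M`, count as one point; weighted sums over the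
graph become sums over the path `0, …, N + 1`. -/
lemma sum_wt_mul (hM : 0 < M) (G : ℕ → ℝ) :
    ∑ v : Vertex N M, wt N M (pos v) * G (pos v) = ∑ k ∈ Finset.range (N + 2), G k := by
  have hM' : (M : ℝ) ≠ 0 := by positivity
  have h1 : ∑ x : Site N, wt N M x * G x = ∑ k ∈ Finset.range N, G (k + 1) := by
    rw [← sum_site]
    exact Finset.sum_congr rfl fun x _ => by rw [wt_of_mem x.2, one_mul]
  rw [Fintype.sum_sum_type, Fintype.sum_sum_type, Finset.sum_range_succ, Finset.sum_range_succ']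
  simp only [pos, h1]
  simp [wt]
  field_simp
  ring

/-- The functions on the vertices that depend only on the position. -/
def lumped (N M : ℕ) : Submodule ℝ (Vertex N M → ℝ) :=
  LinearMap.range (LinearMap.funLeft ℝ ℝ (pos (N := N) (M := M)))

lemma mem_lumped {f : Vertex N M → ℝ} : f ∈ lumped N M ↔ ∃ F : ℕ → ℝ, f = fun v => F (pos v) := by
  constructor
  · rintro ⟨F, rfl⟩; exact ⟨F, rfl⟩
  · rintro ⟨F, rfl⟩; exact ⟨F, rfl⟩

lemma mem_lumped_of_forall {f : Vertex N M → ℝ} (h : ∀ v w, pos v = pos w → f v = f w) :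
    f ∈ lumped N M := by
  have h' : Function.FactorsThrough f pos := fun v w => h v w
  obtain ⟨F, hF⟩ := (Function.factorsThrough_iff f).1 h'
  exact mem_lumped.2 ⟨F, hF⟩

lemma eq_of_mem_lumped {f : Vertex N M → ℝ} (hf : f ∈ lumped N M) {v w : Vertex N M}
    (h : pos v = pos w) : f v = f w := by
  obtain ⟨F, rfl⟩ := mem_lumped.1 hf
  simp only [h]

lemma walkGen_rate_lumped (hM : 0 < M) (F : ℕ → ℝ) (v : Vertex N M) :
    walkGen (rate N M) (fun v => F (pos v)) v = wt N M (pos v) / 2 *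
      ∑ k ∈ Finset.range (N + 2),
        if k = pos v + 1 ∨ pos v = k + 1 then F k - F (pos v) else 0 := by
  rw [walkGen_apply, ← sum_wt_mul hM, Finset.mul_sum]
  refine Finset.sum_congr rfl fun w _ => ?_
  unfold rate
  split_ifs <;> ring

lemma walkGen_mem_lumped (hM : 0 < M) {f : Vertex N M → ℝ} (hf : f ∈ lumped N M) :
    walkGen (rate N M) f ∈ lumped N M := by
  obtain ⟨F, rfl⟩ := mem_lumped.1 hf
  refine mem_lumped_of_forall fun v w h => ?_
  rw [walkGen_rate_lumped hM, walkGen_rate_lumped hM, h]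

lemma flow_mem_lumped (hM : 0 < M) {f : Vertex N M → ℝ} (hf : f ∈ lumped N M) {t : ℝ}
    (ht : 0 ≤ t) : flow (walkGen (rate N M)) t f ∈ lumped N M :=
  flow_mem_submodule _ (fun _ hf => walkGen_mem_lumped hM hf) ht hf

lemma sum_neighbours (F : ℕ → ℝ) {p : ℕ} (hp : p ∈ Finset.Icc 1 N) :
    (∑ k ∈ Finset.range (N + 2), if k = p + 1 ∨ p = k + 1 then F k else 0)
      = F (p + 1) + F (p - 1) := by
  rw [Finset.mem_Icc] at hp
  have h : ∀ k, (if k = p + 1 ∨ p = k + 1 then F k else 0) =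
      (if k = p + 1 then F k else 0) + (if k = p - 1 then F k else 0) := by
    intro k
    by_cases h1 : k = p + 1
    · rw [if_pos (Or.inl h1), if_pos h1, if_neg (by omega), add_zero]
    · by_cases h2 : p = k + 1
      · rw [if_pos (Or.inr h2), if_neg h1, if_pos (by omega), zero_add]
      · rw [if_neg (by tauto), if_neg h1, if_neg (by omega), zero_add]
  simp only [h, Finset.sum_add_distrib, Finset.sum_ite_eq', Finset.mem_range]
  rw [if_pos (by omega), if_pos (by omega)]

lemma walkGen_rate_site (hM : 0 < M) (F : ℕ → ℝ) (x : Site N) :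
    walkGen (rate N M) (fun v => F (pos v)) (Sum.inl x) =
      (F (x + 1) + F (x - 1) - 2 * F x) / 2 := by
  have hp : pos (Sum.inl x : Vertex N M) ∈ Finset.Icc 1 N := x.2
  rw [walkGen_rate_lumped hM, sum_neighbours (fun k => F k - F (pos (Sum.inl x : Vertex N M))) hp,
    wt_of_mem hp]
  simp only [pos]
  ring

/-- Each orientation of a bond contributes half of a squared increment, so the energy is that of the
path with unit conductances, the bonds to the reservoirs included. -/
lemma dirichlet_rate_lumped (hM : 0 < M) (F : ℕ → ℝ) :
    dirichlet (rate N M) (fun v => F (pos v)) (fun v => F (pos v)) =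
      ∑ k ∈ Finset.range (N + 1), (F (k + 1) - F k) ^ 2 := by
  have h1 : dirichlet (rate N M) (fun v => F (pos v)) (fun v => F (pos v)) =
      ∑ j ∈ Finset.range (N + 2), ∑ k ∈ Finset.range (N + 2),
        if k = j + 1 ∨ j = k + 1 then (F j - F k) ^ 2 / 2 else 0 := by
    rw [dirichlet, ← sum_wt_mul hM]
    refine Finset.sum_congr rfl fun v _ => ?_
    rw [← sum_wt_mul hM, Finset.mul_sum]
    refine Finset.sum_congr rfl fun w _ => ?_
    unfold rate
    split_ifs <;> ring
  have h2 : ∀ j k, (if k = j + 1 ∨ j = k + 1 then (F j - F k) ^ 2 / 2 else 0) =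
      (if k = j + 1 then (F j - F k) ^ 2 / 2 else 0)
        + (if j = k + 1 then (F j - F k) ^ 2 / 2 else 0) := by
    intro j k
    by_cases h1 : k = j + 1
    · rw [if_pos (Or.inl h1), if_pos h1, if_neg (by omega), add_zero]
    · by_cases h2 : j = k + 1
      · rw [if_pos (Or.inr h2), if_neg h1, if_pos h2, zero_add]
      · rw [if_neg (by tauto), if_neg h1, if_neg h2, zero_add]
  have h3 : ∑ j ∈ Finset.range (N + 2), ∑ k ∈ Finset.range (N + 2),
      (if k = j + 1 then (F j - F k) ^ 2 / 2 else 0)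
      = ∑ j ∈ Finset.range (N + 1), (F (j + 1) - F j) ^ 2 / 2 := by
    rw [Finset.sum_range_succ]
    simp only [Finset.sum_ite_eq', Finset.mem_range]
    rw [if_neg (by omega), add_zero]
    refine Finset.sum_congr rfl fun j hj => ?_
    rw [Finset.mem_range] at hj
    rw [if_pos (by omega)]; ring
  have h4 : ∑ j ∈ Finset.range (N + 2), ∑ k ∈ Finset.range (N + 2),
      (if j = k + 1 then (F j - F k) ^ 2 / 2 else 0)
      = ∑ j ∈ Finset.range (N + 1), (F (j + 1) - F j) ^ 2 / 2 := by
    rw [Finset.sum_comm, ← h3]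
    refine Finset.sum_congr rfl fun j _ => Finset.sum_congr rfl fun k _ => ?_
    split_ifs <;> ring
  simp only [h1, h2, Finset.sum_add_distrib, h3, h4]
  rw [← Finset.sum_add_distrib]
  exact Finset.sum_congr rfl fun k _ => by ring

lemma sum_range_sq_le (hM : 0 < M) (F : ℕ → ℝ) :
    ∑ k ∈ Finset.range (N + 2), F k ^ 2 ≤ ∑ v : Vertex N M, F (pos v) ^ 2 := by
  rw [← sum_wt_mul hM]
  refine Finset.sum_le_sum fun v _ => ?_
  have h : wt N M (pos v) ≤ 1 := by
    unfold wt
    split_ifs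
    · rw [div_le_one (by positivity)]
      exact_mod_cast hM
    · exact le_rfl
  exact mul_le_of_le_one_left (sq_nonneg _) h

/-- The function takes the same value at all `M` sites of the reservoir, and `M` times this value is
at most the total mass. -/
lemma lumped_reservoir_le {f : Vertex N M → ℝ} (hf : f ∈ lumped N M) (h0 : ∀ v, 0 ≤ f v)
    (z : Fin M ⊕ Fin M) : f (Sum.inr z) ≤ (∑ v, f v) / M := by
  have hM : 0 < M := by rcases z with i | i <;> exact i.pos
  rw [le_div_iff₀ (by positivity), Fintype.sum_sum_type, Fintype.sum_sum_type]
  have h1 := Finset.sum_nonneg fun (x : Site N) (_ : x ∈ Finset.univ) => h0 (Sum.inl x)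
  have h2 := Finset.sum_nonneg fun (x : Fin M) (_ : x ∈ Finset.univ) => h0 (Sum.inr (Sum.inl x))
  have h3 := Finset.sum_nonneg fun (x : Fin M) (_ : x ∈ Finset.univ) => h0 (Sum.inr (Sum.inr x))
  rcases z with i | i
  · have e : ∑ j : Fin M, f (Sum.inr (Sum.inl j)) = f (Sum.inr (Sum.inl i)) * M := by
      rw [Finset.sum_congr rfl fun j _ =>
        eq_of_mem_lumped hf (v := Sum.inr (Sum.inl j)) (w := Sum.inr (Sum.inl i)) rfl]
      simp [mul_comm]
    linarith
  · have e : ∑ j : Fin M, f (Sum.inr (Sum.inr j)) = f (Sum.inr (Sum.inr i)) * M := by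
      rw [Finset.sum_congr rfl fun j _ =>
        eq_of_mem_lumped hf (v := Sum.inr (Sum.inr j)) (w := Sum.inr (Sum.inr i)) rfl]
      simp [mul_comm]
    linarith

/-- A Nash inequality for probability densities on the graph. -/
lemma nash_inequality (hM : 0 < M) {f : Vertex N M → ℝ} (hf : f ∈ lumped N M)
    (h0 : ∀ v, 0 ≤ f v) (h1 : ∑ v, f v = 1) :
    (∑ v, f v ^ 2) ^ 2 ≤ (1 / (M : ℝ)) ^ 2
      + 2 * √((∑ v, f v ^ 2) * dirichlet (rate N M) f f) := by
  have hres := lumped_reservoir_le hf h0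
  rw [h1] at hres
  obtain ⟨F, rfl⟩ := mem_lumped.1 hf
  set y := ∑ v : Vertex N M, F (pos v) ^ 2 with hy
  set D := dirichlet (rate N M) (fun v => F (pos v)) (fun v => F (pos v)) with hD
  have hy0 : 0 ≤ y := Finset.sum_nonneg fun v _ => sq_nonneg _
  -- The left reservoir provides the small starting value for the telescoping sum along the path.
  have hF0 : F 0 ^ 2 ≤ (1 / (M : ℝ)) ^ 2 := by
    have e := hres (Sum.inl ⟨0, hM⟩)
    have e' := h0 (Sum.inr (Sum.inl ⟨0, hM⟩))
    simp only [pos] at e e'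
    exact pow_le_pow_left₀ e' e 2
  have hkey : ∀ p ≤ N + 1, F p ^ 2 ≤ (1 / (M : ℝ)) ^ 2 + 2 * √(y * D) := by
    intro p hp
    -- Telescoping of the squares and Cauchy–Schwarz bound `|F p ^ 2 - F 0 ^ 2|` by `√(D * 4 y)`.
    have t1 : F p ^ 2 - F 0 ^ 2 = ∑ k ∈ Finset.range p, (F (k + 1) - F k) * (F (k + 1) + F k) := by
      rw [← Finset.sum_range_sub (fun k => F k ^ 2)]
      exact Finset.sum_congr rfl fun k _ => by ring
    have t2 := Finset.sum_mul_sq_le_sq_mul_sq (Finset.range p) (fun k => F (k + 1) - F k)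
      (fun k => F (k + 1) + F k)
    have hsub : Finset.range p ⊆ Finset.range (N + 1) := Finset.range_subset_range.2 hp
    have t3 : ∑ k ∈ Finset.range p, (F (k + 1) - F k) ^ 2 ≤ D := by
      rw [hD, dirichlet_rate_lumped hM]
      exact Finset.sum_le_sum_of_subset_of_nonneg hsub fun _ _ _ => sq_nonneg _
    have t4 : ∑ k ∈ Finset.range p, (F (k + 1) + F k) ^ 2 ≤ 4 * y := by
      have a1 : ∑ k ∈ Finset.range p, (F (k + 1) + F k) ^ 2
          ≤ ∑ k ∈ Finset.range (N + 1), (2 * F (k + 1) ^ 2 + 2 * F k ^ 2) := by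
        refine (Finset.sum_le_sum_of_subset_of_nonneg hsub fun _ _ _ => sq_nonneg _).trans ?_
        exact Finset.sum_le_sum fun k _ => by nlinarith [sq_nonneg (F (k + 1) - F k)]
      have a2 := sum_range_sq_le (N := N) hM F
      have a3 := Finset.sum_range_succ' (fun k => F k ^ 2) (N + 1)
      have a4 := Finset.sum_range_succ (fun k => F k ^ 2) (N + 1)
      rw [Finset.sum_add_distrib, ← Finset.mul_sum, ← Finset.mul_sum] at a1
      nlinarith [sq_nonneg (F 0), sq_nonneg (F (N + 1))]
    have t5 : (F p ^ 2 - F 0 ^ 2) ^ 2 ≤ (2 * √(y * D)) ^ 2 := by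
      have hD0 : 0 ≤ D := dirichlet_self_nonneg rate_nonneg _
      rw [t1, mul_pow, Real.sq_sqrt (mul_nonneg hy0 hD0)]
      refine t2.trans ?_
      calc _ ≤ D * (4 * y) := mul_le_mul t3 t4 (Finset.sum_nonneg fun _ _ => sq_nonneg _) hD0
        _ = _ := by ring
    have t6 := abs_le_of_sq_le_sq t5 (by positivity)
    linarith [le_of_abs_le t6]
  set B := (1 / (M : ℝ)) ^ 2 + 2 * √(y * D) with hB
  have hB0 : 0 ≤ B := by positivity
  -- The sum of the squares is at most the supremum `√B` times the total mass `1`.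
  have hle : y ≤ √B := by
    calc y ≤ ∑ v : Vertex N M, √B * F (pos v) := by
          refine Finset.sum_le_sum fun v _ => ?_
          rw [sq]
          exact mul_le_mul_of_nonneg_right (Real.le_sqrt_of_sq_le (hkey _ (pos_le v))) (h0 v)
      _ = √B := by rw [← Finset.mul_sum, h1, mul_one]
  calc y ^ 2 ≤ √B ^ 2 := pow_le_pow_left₀ hy0 hle 2
    _ = B := Real.sq_sqrt hB0

end Graph

/-! ### Decay of the heat kernel and escape from the channel -/

section HeatKernel

variable {N M : ℕ}

lemma single_mem_lumped (a : Site N) :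
    (Pi.single (Sum.inl a) 1 : Vertex N M → ℝ) ∈ lumped N M := by
  refine mem_lumped.2 ⟨fun k => if k = a then 1 else 0, ?_⟩
  have ha := Finset.mem_Icc.1 a.2
  funext v
  rcases v with x | i | i
  · by_cases h : x = a
    · subst h; simp [pos]
    · have h' : (x : ℕ) ≠ a := fun e => h (Subtype.ext e)
      have h2 : (Sum.inl x : Vertex N M) ≠ Sum.inl a := fun e => h (Sum.inl.inj e)
      simp [pos, h', Pi.single_eq_of_ne h2]
  · have h2 : (Sum.inr (Sum.inl i) : Vertex N M) ≠ Sum.inl a := Sum.inr_ne_inl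
    rw [Pi.single_eq_of_ne h2]
    exact (if_neg (show ¬ 0 = (a : ℕ) by omega)).symm
  · have h2 : (Sum.inr (Sum.inr i) : Vertex N M) ≠ Sum.inl a := Sum.inr_ne_inl
    rw [Pi.single_eq_of_ne h2]
    exact (if_neg (show ¬ N + 1 = (a : ℕ) by omega)).symm

lemma single_mem_Icc (v w : Vertex N M) :
    (Pi.single v 1 : Vertex N M → ℝ) w ∈ Set.Icc (0 : ℝ) 1 := by
  by_cases h : w = v
  · subst h; simp
  · simp [Pi.single_eq_of_ne h]

lemma sum_single_one (v : Vertex N M) : ∑ w, (Pi.single v 1 : Vertex N M → ℝ) w = 1 := by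
  simp

/-- The decay of the `ℓ²`-norm of the heat kernel started at a site of the channel. -/
lemma sum_sq_flow_single_le (hM : 0 < M) (a : Site N) {t : ℝ} (ht : 0 < t) :
    ∑ v : Vertex N M, flow (walkGen (rate N M)) t (Pi.single (Sum.inl a) 1) v ^ 2
      ≤ 2 / √t + 2 / M := by
  set f : ℝ → Vertex N M → ℝ := fun r => flow (walkGen (rate N M)) r (Pi.single (Sum.inl a) 1)
    with hf
  set y : ℝ → ℝ := fun r => ∑ v, f r v ^ 2 with hy
  set D : ℝ → ℝ := fun r => dirichlet (rate N M) (f r) (f r) with hD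
  have hD0 : ∀ r, 0 ≤ D r := fun r => dirichlet_self_nonneg rate_nonneg _
  have hyd : ∀ r, HasDerivAt y (-D r) r := fun r => by
    simpa only [Pi.zero_apply, sub_zero] using hasDerivAt_sum_sq_sub rate_symm
      (hasDerivAt_flow_apply (walkGen (rate N M)) (Pi.single (Sum.inl a) 1) r) 0
  have hnash : ∀ r, 0 ≤ r → y r ^ 2 ≤ (1 / (M : ℝ)) ^ 2 + 2 * √(y r * D r) := fun r hr =>
    nash_inequality hM (flow_mem_lumped hM (single_mem_lumped a) hr)
      (fun v => (flow_walkGen_mem_Icc rate_nonneg (single_mem_Icc _) hr v).1)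
      ((sum_flow_walkGen rate_nonneg rate_symm _ hr).trans (sum_single_one _))
  -- Since `y` decreases, a large value at time `t` keeps `y` above `2 / M` on all of `[0, t]`.
  -- There the reservoir term in the Nash inequality is harmless, and the differential inequality
  -- for `y` forces a decay that contradicts the assumption.
  by_contra! hcon
  change 2 / √t + 2 / M < y t at hcon
  have hδ : 0 < 1 / (M : ℝ) := by positivity
  have hst : 0 < 2 / √t := by positivity
  have hmono : ∀ r ∈ Set.Icc 0 t, y t ≤ y r := fun r hr => by
    have := monotoneOn_of_hasDerivAt_nonneg (φ := fun r => -y r) (a := 0) (b := t)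
      (fun r _ => (hyd r).neg) (fun r _ => by simpa using hD0 r) hr ⟨ht.le, le_rfl⟩ hr.2
    simpa using this
  have hybig : ∀ r ∈ Set.Icc 0 t, 2 * (1 / (M : ℝ)) < y r := fun r hr => by
    have := hmono r hr
    have e : 2 * (1 / (M : ℝ)) = 2 / M := by ring
    linarith
  have hypos : ∀ r ∈ Set.Icc 0 t, 0 < y r := fun r hr => by linarith [hybig r hr]
  have hlow : ∀ r ∈ Set.Icc 0 t, 9 / 64 * y r ^ 4 ≤ y r * D r := fun r hr => by
    have h1 := hnash r hr.1
    have h2 := hybig r hr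
    -- As `(1 / M) ^ 2 ≤ y ^ 2 / 4`, the Nash inequality leaves `3 / 4 * y ^ 2 ≤ 2 * √(y D)`.
    have h3 : 3 / 8 * y r ^ 2 ≤ √(y r * D r) := by nlinarith
    have h4 := pow_le_pow_left₀ (by positivity) h3 2
    rw [Real.sq_sqrt (mul_nonneg (hypos r hr).le (hD0 r))] at h4
    calc _ = (3 / 8 * y r ^ 2) ^ 2 := by ring
      _ ≤ _ := h4
  -- The derivative of `y⁻²` is `2 D / y ^ 3 ≥ 9 / 32`, and `9 / 32 > 1 / 4` is enough to contradict
  -- `y t ^ 2 > 4 / t`.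
  have hz := monotoneOn_of_hasDerivAt_nonneg (φ := fun r => (y r ^ 2)⁻¹ - 9 / 32 * r)
    (φ' := fun r => -(((2 : ℕ) : ℝ) * y r ^ (2 - 1) * -D r) / (y r ^ 2) ^ 2 - 9 / 32 * 1)
    (a := 0) (b := t)
    (fun r hr => (((hyd r).pow 2).inv (pow_pos (hypos r hr) 2).ne').sub
      ((hasDerivAt_id r).const_mul _))
    (fun r hr => by
      have h1 := hlow r hr
      have h2 : 0 < (y r ^ 2) ^ 2 := by have := hypos r hr; positivity
      rw [sub_nonneg, le_div_iff₀ h2]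
      push_cast
      nlinarith)
    ⟨le_rfl, ht.le⟩ ⟨ht.le, le_rfl⟩ ht.le
  have h0 : 0 < (y 0 ^ 2)⁻¹ := by have := hypos 0 ⟨le_rfl, ht.le⟩; positivity
  simp only [mul_zero, sub_zero] at hz
  have hyt := hypos t ⟨ht.le, le_rfl⟩
  have h5 : 4 / t < y t ^ 2 := by
    have h6 : (2 / √t) ^ 2 = 4 / t := by rw [div_pow, Real.sq_sqrt ht.le]; norm_num
    rw [← h6]
    refine pow_lt_pow_left₀ ?_ hst.le two_ne_zero
    have : (0 : ℝ) < 2 / M := by positivity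
    linarith
  have h7 : (y t ^ 2)⁻¹ < t / 4 := by
    rw [inv_lt_comm₀ (by positivity) (by positivity), inv_div]; exact h5
  linarith

/-- The transition probabilities to sites of the channel decay. -/
lemma flow_single_site_le (hM : 0 < M) (x : Site N) (v : Vertex N M) {t : ℝ} (ht : 0 ≤ t) :
    flow (walkGen (rate N M)) t (Pi.single v 1) (Sum.inl x) ≤ √(32 / (1 + t) + 8 / (M : ℝ) ^ 2) := by
  have hsym : flow (walkGen (rate N M)) t (Pi.single v 1) (Sum.inl x)
      = flow (walkGen (rate N M)) t (Pi.single (Sum.inl x) 1) v := by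
    have := flow_walkGen_selfAdjoint (rate_symm (N := N) (M := M)) (Pi.single (Sum.inl x) 1)
      (Pi.single v 1) t
    simpa [Pi.single_apply] using this
  have hIcc := flow_walkGen_mem_Icc rate_nonneg (single_mem_Icc v) ht (Sum.inl x)
  refine Real.le_sqrt_of_sq_le ?_
  have hM2 : (0 : ℝ) ≤ 8 / (M : ℝ) ^ 2 := by positivity
  -- For `t < 1` the right side exceeds `1`, so the bound is trivial; for `t ≥ 1` one has `16 / t ≤
  -- 32 / (1 + t)`.
  rcases lt_or_ge t 1 with h1 | h1
  · have : (1 : ℝ) ≤ 32 / (1 + t) := by rw [le_div_iff₀ (by linarith)]; linarith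
    nlinarith [hIcc.1, hIcc.2]
  · have ht0 : 0 < t := by linarith
    have key : flow (walkGen (rate N M)) t (Pi.single v 1) (Sum.inl x) ≤ 2 / √(t / 2) + 2 / M := by
      rw [hsym]
      -- A site is treated by splitting at time `t / 2` and `2ab ≤ a² + b²`. For a reservoir vertex,
      -- the kernel started at `x` has the same value at all `M` sites, so it is at most `1 / M`.
      rcases v with z | z
      · have h2 := sum_flow_sub_mul_flow (rate_symm (N := N) (M := M)) (Pi.single (Sum.inl z) 1)
          (Pi.single (Sum.inl x) 1) t (t / 2)
        rw [sub_half] at h2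
        have h3 : ∑ w, flow (walkGen (rate N M)) t (Pi.single (Sum.inl x) 1) w
            * (Pi.single (Sum.inl z) 1 : Vertex N M → ℝ) w
            = flow (walkGen (rate N M)) t (Pi.single (Sum.inl x) 1) (Sum.inl z) := by
          simp [Pi.single_apply]
        rw [← h3, ← h2]
        have h4 := sum_sq_flow_single_le hM x (half_pos ht0)
        have h5 := sum_sq_flow_single_le hM z (half_pos ht0)
        have h6 : ∑ w, flow (walkGen (rate N M)) (t / 2) (Pi.single (Sum.inl x) 1) w
            * flow (walkGen (rate N M)) (t / 2) (Pi.single (Sum.inl z) 1) w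
            ≤ ∑ w, (flow (walkGen (rate N M)) (t / 2) (Pi.single (Sum.inl x) 1) w ^ 2 / 2
            + flow (walkGen (rate N M)) (t / 2) (Pi.single (Sum.inl z) 1) w ^ 2 / 2) :=
          Finset.sum_le_sum fun w _ => by
            nlinarith [sq_nonneg (flow (walkGen (rate N M)) (t / 2) (Pi.single (Sum.inl x) 1) w
              - flow (walkGen (rate N M)) (t / 2) (Pi.single (Sum.inl z) 1) w)]
        rw [Finset.sum_add_distrib, ← Finset.sum_div, ← Finset.sum_div] at h6
        linarith
      · have h2 := lumped_reservoir_le (flow_mem_lumped hM (single_mem_lumped x) ht)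
          (fun v => (flow_walkGen_mem_Icc rate_nonneg (single_mem_Icc _) ht v).1) z
        rw [sum_flow_walkGen rate_nonneg rate_symm _ ht, sum_single_one] at h2
        have h3 : 0 ≤ 2 / √(t / 2) := by positivity
        have h4 : (1 : ℝ) / M ≤ 2 / M := by gcongr; norm_num
        linarith
    have hsq : (2 / √(t / 2)) ^ 2 = 8 / t := by
      rw [div_pow, Real.sq_sqrt (by positivity)]; field_simp; norm_num
    have hsq2 : (2 / (M : ℝ)) ^ 2 = 4 / (M : ℝ) ^ 2 := by rw [div_pow]; norm_num
    have h16 : 16 / t ≤ 32 / (1 + t) := by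
      rw [div_le_div_iff₀ ht0 (by linarith)]; linarith
    calc _ ≤ (2 / √(t / 2) + 2 / M) ^ 2 := pow_le_pow_left₀ hIcc.1 key 2
      _ ≤ 2 * (2 / √(t / 2)) ^ 2 + 2 * (2 / (M : ℝ)) ^ 2 := by
        nlinarith [sq_nonneg (2 / √(t / 2) - 2 / (M : ℝ))]
      _ = 16 / t + 8 / (M : ℝ) ^ 2 := by rw [hsq, hsq2]; ring
      _ ≤ _ := by linarith

/-- The indicator function of the channel. -/
def channel (N M : ℕ) (v : Vertex N M) : ℝ := if pos v ∈ Finset.Icc 1 N then 1 else 0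

lemma channel_site (x : Site N) : channel N M (Sum.inl x) = 1 := if_pos x.2

lemma channel_reservoir (z : Fin M ⊕ Fin M) : channel N M (Sum.inr z) = 0 := by
  rcases z with i | i <;> simp [channel, pos]

lemma channel_mem_lumped : channel N M ∈ lumped N M :=
  mem_lumped.2 ⟨fun k => if k ∈ Finset.Icc 1 N then 1 else 0, rfl⟩

lemma channel_mem_Icc (v : Vertex N M) : channel N M v ∈ Set.Icc (0 : ℝ) 1 := by
  unfold channel; split_ifs <;> simp

lemma sum_channel : ∑ v, channel N M v = N := by
  rw [Fintype.sum_sum_type]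
  simp [channel_site, channel_reservoir]

/-- The generator of the walk killed outside of the channel. -/
def killedGen (N M : ℕ) : (Vertex N M → ℝ) →ₗ[ℝ] (Vertex N M → ℝ) where
  toFun f v := channel N M v * walkGen (rate N M) (fun w => channel N M w * f w) v
  map_add' f g := by
    funext v
    have e : (fun w => channel N M w * (f + g) w)
        = (fun w => channel N M w * f w) + fun w => channel N M w * g w := by
      funext w; simp [mul_add]
    rw [e, map_add]
    simp [mul_add]
  map_smul' a f := by
    funext v
    have e : (fun w => channel N M w * (a • f) w) = a • fun w => channel N M w * f w := by
      funext w; simp; ring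
    rw [e, map_smul]
    simp; ring

lemma killedGen_apply (f : Vertex N M → ℝ) (v : Vertex N M) :
    killedGen N M f v = channel N M v * walkGen (rate N M) (fun w => channel N M w * f w) v := rfl

lemma isMetzler_killedGen : IsMetzler (killedGen N M) := by
  obtain ⟨b, hb⟩ := isMetzler_walkGen (rate_nonneg (N := N) (M := M))
  refine ⟨|b|, fun f hf v => ?_⟩
  have h := hb (fun w => channel N M w * f w) (fun w => mul_nonneg (channel_mem_Icc w).1 (hf w)) v
  have hfv := hf v
  simp only [Pi.add_apply, Pi.smul_apply, smul_eq_mul, Pi.zero_apply] at h hfv ⊢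
  rw [killedGen_apply]
  rcases v with x | z
  · rw [channel_site] at h ⊢
    nlinarith [le_abs_self b]
  · rw [channel_reservoir]
    have := abs_nonneg b
    rw [zero_mul, zero_add]
    positivity

/-- The probability to be in the channel at time `s`. -/
lemma flow_channel_le (hM : 0 < M) (x : Site N) {s : ℝ} (hs : 0 < s) :
    flow (walkGen (rate N M)) s (channel N M) (Sum.inl x)
      ≤ (N : ℝ) / M + (x : ℝ) * (N + 1 - x) / s := by
  set f : ℝ → Vertex N M → ℝ := fun r => flow (walkGen (rate N M)) r (channel N M) with hf
  -- `ψ` is the mean exit time from the channel: its generator is `-1` there and it vanishes in the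
  -- reservoirs. Hence `h` below solves the heat equation in the channel, dominates the indicator of
  -- the channel at time `0` and the value `N / M` in the reservoirs up to time `s`, and equals the
  -- claimed bound at time `s`.
  set ψ : ℕ → ℝ := fun k => (k : ℝ) * (N + 1 - k) with hψ
  set h : ℝ → Vertex N M → ℝ := fun r v => (N : ℝ) / M + (1 - r / s) + ψ (pos v) / s with hh
  have hres : ∀ r, 0 ≤ r → ∀ z, f r (Sum.inr z) ≤ N / M := fun r hr z => by
    have h1 := lumped_reservoir_le (N := N) (flow_mem_lumped hM channel_mem_lumped hr)
      (fun v => (flow_walkGen_mem_Icc rate_nonneg channel_mem_Icc hr v).1) z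
    rwa [sum_flow_walkGen rate_nonneg rate_symm _ hr, sum_channel] at h1
  have hψ0 : ∀ v : Vertex N M, 0 ≤ ψ (pos v) := fun v => by
    have : ((pos v : ℕ) : ℝ) ≤ N + 1 := by exact_mod_cast pos_le v
    exact mul_nonneg (by positivity) (by linarith)
  have hgen : ∀ r (y : Site N), walkGen (rate N M) (h r) (Sum.inl y) = -(1 / s) := by
    intro r y
    rw [walkGen_rate_site hM (fun k => (N : ℝ) / M + (1 - r / s) + ψ k / s) y]
    have hy : (((y : ℕ) - 1 : ℕ) : ℝ) = (y : ℝ) - 1 := by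
      have := (Finset.mem_Icc.1 y.2).1
      push_cast [this]; ring
    simp only [hψ, hy]
    push_cast
    field_simp
    ring
  have hdu : ∀ r, HasDerivAt (fun r v => channel N M v * (f r v - h r v))
      (fun v => channel N M v * (walkGen (rate N M) (f r) v - -(1 / s))) r := by
    intro r
    rw [hasDerivAt_pi]
    intro v
    have h1 := hasDerivAt_pi.1 (hasDerivAt_flow_apply (walkGen (rate N M)) (channel N M) r) v
    have h2 : HasDerivAt (fun r => h r v) (-(1 / s)) r := by
      exact ((((hasDerivAt_id r).div_const s).const_sub 1).const_add ((N : ℝ) / M)).add_const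
        (ψ (pos v) / s)
    exact (h1.sub h2).const_mul _
  -- In the reservoirs `f - h ≤ 0`. Replacing it by `0` there only increases the generator, so `f -
  -- h` cut off to the channel is a subsolution for the killed walk.
  have hcmp := le_flow_of_deriv_le isMetzler_killedGen hs.le (fun r _ => hdu r) (fun r hr v => by
    rw [killedGen_apply]
    rcases v with y | z
    · rw [channel_site, one_mul, one_mul, ← hgen r y, ← Pi.sub_apply, ← map_sub, walkGen_apply,
        walkGen_apply]
      refine Finset.sum_le_sum fun w _ => mul_le_mul_of_nonneg_left ?_ (rate_nonneg _ _)
      rcases w with w | z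
      · simp [channel_site]
      · have h1 := hres r hr.1 z
        have h2 : (N : ℝ) / M ≤ h r (Sum.inr z) := by
          have h3 : r / s ≤ 1 := (div_le_one hs).2 hr.2
          have h4 : 0 ≤ ψ (pos (Sum.inr z : Vertex N M)) / s := div_nonneg (hψ0 _) hs.le
          simp only [hh]
          linarith
        simp only [Pi.sub_apply, channel_site, channel_reservoir]
        linarith
    · simp [channel_reservoir])
  have hneg : flow (killedGen N M) s (fun v => channel N M v * (f 0 v - h 0 v)) ≤ 0 := by
    have h1 := flow_mono (isMetzler_killedGen (N := N) (M := M)) hs.le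
      (f := fun v => channel N M v * (f 0 v - h 0 v)) (g := 0) (fun v => by
        have h2 : 0 ≤ ψ (pos v) / s := div_nonneg (hψ0 _) hs.le
        have h3 : (0 : ℝ) ≤ (N : ℝ) / M := by positivity
        have h4 := channel_mem_Icc v
        simp only [hf, flow_zero, hh, zero_div, sub_zero, one_apply_eq_self]
        exact mul_nonpos_of_nonneg_of_nonpos h4.1 (by linarith [h4.2]))
    rwa [map_zero] at h1
  have := (hcmp.trans hneg) (Sum.inl x)
  simp only [channel_site, one_mul, hh, Pi.zero_apply, div_self hs.ne', sub_self, add_zero, pos,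
    hψ] at this
  linarith

end HeatKernel

/-! ### Bounds for the source term and for the evolved initial correlations -/

section Correlation

/-- Young's inequality `a (a - b) ≥ a² / 2 - b² / 2` on every edge. -/
lemma dirichlet_sub_ge {V : Type*} [Fintype V] {c : V → V → ℝ} (hc : ∀ x y, 0 ≤ c x y)
    (u l : V → ℝ) :
    dirichlet c u u / 2 - dirichlet c l l / 2 ≤ dirichlet c u (fun x => u x - l x) := by
  simp only [dirichlet, Finset.sum_div, ← Finset.sum_sub_distrib]
  refine Finset.sum_le_sum fun x _ => Finset.sum_le_sum fun y _ => ?_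
  nlinarith [mul_nonneg (hc x y) (sq_nonneg ((u x - u y) - (l x - l y)))]

variable {N M : ℕ}

/-- The linear interpolation of the values in the reservoirs. -/
lemma exists_linear_profile (hN : 0 < N) (hM : 0 < M) {f : Vertex N M → ℝ} (hf : f ∈ lumped N M)
    (h01 : ∀ v, f v ∈ Set.Icc (0 : ℝ) 1) :
    ∃ l : Vertex N M → ℝ, ∑ v, (f v - l v) ^ 2 ≤ N ∧ dirichlet (rate N M) l l ≤ 1 / N := by
  obtain ⟨F, rfl⟩ := mem_lumped.1 hf
  have ha := h01 (Sum.inr (Sum.inl ⟨0, hM⟩))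
  have hb := h01 (Sum.inr (Sum.inr ⟨0, hM⟩))
  simp only [pos] at ha hb
  set a := F 0
  set b := F (N + 1)
  have hN1 : (0 : ℝ) < N + 1 := by positivity
  -- The profile agrees with `f` in the reservoirs, so their `2M` sites add nothing to the distance
  -- and only the `N` channel sites count. The energy is `(b - a) ^ 2 / (N + 1)`.
  refine ⟨fun v => (fun k : ℕ => a + k * ((b - a) / (N + 1))) (pos v), ?_, ?_⟩
  · rw [Fintype.sum_sum_type, Fintype.sum_sum_type]
    have h1 : ∑ x : Site N, (F (pos (Sum.inl x : Vertex N M))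
        - (a + (pos (Sum.inl x : Vertex N M) : ℕ) * ((b - a) / (N + 1)))) ^ 2 ≤ ∑ x : Site N, 1 := by
      refine Finset.sum_le_sum fun x _ => ?_
      have h2 := h01 (Sum.inl x)
      simp only [pos] at h2 ⊢
      have hx := Finset.mem_Icc.1 x.2
      have hx2 : ((x : ℕ) : ℝ) ≤ N := by exact_mod_cast hx.2
      set θ : ℝ := (x : ℝ) / (N + 1) with hθ
      have hθ0 : 0 ≤ θ := by positivity
      have hθ1 : θ ≤ 1 := by rw [hθ, div_le_one hN1]; linarith
      have e : a + (x : ℝ) * ((b - a) / (N + 1)) = (1 - θ) * a + θ * b := by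
        rw [hθ]; field_simp; ring
      rw [e]
      have l1 : 0 ≤ (1 - θ) * a + θ * b :=
        add_nonneg (mul_nonneg (by linarith) ha.1) (mul_nonneg hθ0 hb.1)
      have l2 : (1 - θ) * a + θ * b ≤ 1 := by nlinarith [ha.2, hb.2]
      rw [sq_le_one_iff_abs_le_one, abs_le]
      constructor <;> linarith [h2.1, h2.2]
    have h3 : ∑ x : Site N, (1 : ℝ) = N := by simp
    have h4 : b - (a + ((N + 1 : ℕ) : ℝ) * ((b - a) / (N + 1))) = 0 := by
      push_cast; field_simp; ring
    simp only [pos] at h1 ⊢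
    have h4' : F (N + 1) - (a + ((N + 1 : ℕ) : ℝ) * ((b - a) / (N + 1))) = 0 := h4
    have h5 : F 0 - (a + ((0 : ℕ) : ℝ) * ((b - a) / (N + 1))) = 0 := by simp [a]
    simp only [h4', h5]
    simp only [ne_eq, OfNat.ofNat_ne_zero, not_false_eq_true, zero_pow, Finset.sum_const_zero,
      add_zero]
    linarith
  · refine (dirichlet_rate_lumped hM (fun k : ℕ => a + k * ((b - a) / (N + 1)))).trans_le ?_
    have h1 : ∀ k : ℕ, (a + ((k + 1 : ℕ) : ℝ) * ((b - a) / (N + 1))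
        - (a + (k : ℝ) * ((b - a) / (N + 1)))) ^ 2 = ((b - a) / (N + 1)) ^ 2 := by
      intro k; push_cast; ring
    simp only [h1, Finset.sum_const, Finset.card_range, nsmul_eq_mul]
    have h2 : (b - a) ^ 2 ≤ 1 := by
      rw [sq_le_one_iff_abs_le_one, abs_le]
      constructor <;> linarith [ha.1, ha.2, hb.1, hb.2]
    have h3 : ((N + 1 : ℕ) : ℝ) * ((b - a) / (N + 1)) ^ 2 = (b - a) ^ 2 / (N + 1) := by
      push_cast; field_simp
    rw [h3]
    have hN0 : (0 : ℝ) < N := by positivity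
    exact div_le_div₀ zero_le_one h2 hN0 (by linarith)

/-- The bound for the correlations which are created by the exclusion up to time `s`. -/
def sourceBound (N M : ℕ) (s : ℝ) : ℝ :=
  4 * ((64 / s + 8 / (M : ℝ) ^ 2) * (2 * N + s / (2 * N))
    + (4 * N / s + 1 / N) * (32 * Real.log (1 + s / 2) + 4 * s / (M : ℝ) ^ 2))

/-- Duhamel's formula: `w` runs from the evolved initial value at `r = 0` to `K s` at `r = s`, and
`-4 q ^ 2 * e ≤ w' ≤ 0`, with `q` at time `s - r` and `e` the energy of `U r`. Before `s / 2` the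
factor `q` is small and the integrated energy is controlled; afterwards the energy is small and `q ^
2` is integrated. Each integral estimate takes the form of monotonicity of an auxiliary function. -/
lemma abs_sub_flow_le_sourceBound (hN : 0 < N) (hM : 0 < M) {U : ℝ → Vertex N M → ℝ}
    {K : ℝ → Vertex N M × Vertex N M → ℝ}
    (hU : ∀ r, HasDerivAt U (walkGen (rate N M) (U r)) r) (hU0 : U 0 ∈ lumped N M)
    (hU01 : ∀ v, U 0 v ∈ Set.Icc (0 : ℝ) 1)
    (hK : ∀ r, HasDerivAt K (pairGen (rate N M) (K r)
      - offDiag fun a b => rate N M a b * (U r a - U r b) ^ 2) r)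
    {s : ℝ} (hs : 0 < s) {x y : Site N} (hxy : x ≠ y) :
    |K s (Sum.inl x, Sum.inl y) - flow (pairGen (rate N M)) s (K 0) (Sum.inl x, Sum.inl y)|
      ≤ sourceBound N M s := by
  have hne : (Sum.inl x : Vertex N M) ≠ Sum.inl y := fun h => hxy (Sum.inl.inj h)
  have hN0 : (0 : ℝ) < N := by positivity
  have hM0 : (0 : ℝ) < M := by positivity
  obtain ⟨l, hl0, hl1⟩ := exists_linear_profile hN hM hU0 hU01
  set Φ : ℝ → ℝ := fun r => ∑ v, (U r v - l v) ^ 2 with hΦ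
  set Φ' : ℝ → ℝ := fun r => -dirichlet (rate N M) (U r) (fun v => U r v - l v) with hΦ'
  set e : ℝ → ℝ := fun r => dirichlet (rate N M) (U r) (U r) with he
  set S : ℝ → Vertex N M × Vertex N M → ℝ :=
    fun r => offDiag fun a b => rate N M a b * (U r a - U r b) ^ 2 with hS
  set w : ℝ → ℝ := fun r => flow (pairGen (rate N M)) (s - r) (K r) (Sum.inl x, Sum.inl y) with hw
  set w' : ℝ → ℝ := fun r => -flow (pairGen (rate N M)) (s - r) (S r) (Sum.inl x, Sum.inl y)
    with hw'
  have he0 : ∀ r, 0 ≤ e r := fun r => dirichlet_self_nonneg rate_nonneg _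
  have hΦ0 : ∀ r, 0 ≤ Φ r := fun r => Finset.sum_nonneg fun v _ => sq_nonneg _
  have hΦd : ∀ r, HasDerivAt Φ (Φ' r) r := fun r => hasDerivAt_sum_sq_sub rate_symm (hU r) l
  have hΦle : ∀ r, Φ' r ≤ -(e r / 2) + 1 / N / 2 := fun r => by
    have := dirichlet_sub_ge (rate_nonneg (N := N) (M := M)) (U r) l
    simp only [hΦ', he]
    linarith
  have hed : ∀ r, HasDerivAt e (-4 * ∑ v, walkGen (rate N M) (U r) v ^ 2) r := fun r =>
    hasDerivAt_dirichlet_self rate_symm (hU r)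
  have heanti : ∀ r r', r ≤ r' → e r' ≤ e r := fun r r' hr => by
    have := monotoneOn_of_hasDerivAt_nonneg (φ := fun r => -e r) (a := r) (b := r')
      (fun r _ => (hed r).neg) (fun r _ => by
        have := Finset.sum_nonneg fun (v : Vertex N M) (_ : v ∈ Finset.univ) =>
          sq_nonneg (walkGen (rate N M) (U r) v)
        linarith) ⟨le_rfl, hr⟩ ⟨hr, le_rfl⟩ hr
    simpa using this
  have hwd : ∀ r, HasDerivAt w (w' r) r := fun r => by
    have := hasDerivAt_pi.1 (hasDerivAt_flow_sub_apply (pairGen (rate N M)) s r (hK r))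
      (Sum.inl x, Sum.inl y)
    rw [sub_sub_cancel_left, map_neg] at this
    exact this
  have hw0 : ∀ r ∈ Set.Icc 0 s, w' r ≤ 0 := fun r hr => by
    have h1 : 0 ≤ S r := fun p => by
      simp only [hS, offDiag]
      split_ifs
      · exact le_rfl
      · exact mul_nonneg (rate_nonneg _ _) (sq_nonneg _)
    have := flow_nonneg (isMetzler_pairGen rate_nonneg) (sub_nonneg.2 hr.2) h1
      (Sum.inl x, Sum.inl y)
    simp only [Pi.zero_apply] at this
    simp only [hw']
    linarith
  have hw1 : ∀ r ∈ Set.Icc 0 s, -(4 * (32 / (1 + (s - r)) + 8 / (M : ℝ) ^ 2) * e r) ≤ w' r :=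
    fun r hr => by
      have hsr : 0 ≤ s - r := sub_nonneg.2 hr.2
      have := flow_pairGen_source_le rate_nonneg rate_symm (U r) hsr hne
        (fun v => flow_single_site_le hM x v hsr) (fun v => flow_single_site_le hM y v hsr)
      rw [Real.sq_sqrt (by positivity)] at this
      simp only [hw', hS, he]
      linarith
  have hs2 : 0 < s / 2 := by positivity
  -- the energy at time `s / 2`
  have hE : e (s / 2) ≤ 4 * N / s + 1 / N := by
    -- On `[0, s / 2]` the energy is at least `e (s / 2)`, so `Φ` decreases at least at the rate `e
    -- (s / 2) / 2 - 1 / (2 N)`, starting from at most `N`.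
    have := monotoneOn_of_hasDerivAt_nonneg
      (φ := fun r => -Φ r + (1 / N / 2 - e (s / 2) / 2) * r)
      (φ' := fun r => -Φ' r + (1 / N / 2 - e (s / 2) / 2) * 1) (a := 0) (b := s / 2)
      (fun r _ => (hΦd r).neg.add ((hasDerivAt_id r).const_mul _))
      (fun r hr => by
        have h1 := hΦle r
        have h2 := heanti r (s / 2) hr.2
        linarith) ⟨le_rfl, hs2.le⟩ ⟨hs2.le, le_rfl⟩ hs2.le
    simp only [mul_zero, add_zero] at this
    have h3 := hΦ0 (s / 2)
    have h4 : Φ 0 ≤ N := hl0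
    have h5 : e (s / 2) * (s / 4) ≤ N + 1 / N * (s / 4) := by linarith
    calc e (s / 2) = e (s / 2) * (s / 4) * (4 / s) := by field_simp
      _ ≤ (N + 1 / N * (s / 4)) * (4 / s) := by gcongr
      _ = _ := by field_simp
  -- the first half of the time interval
  have hfirst : w 0 - 4 * ((64 / s + 8 / (M : ℝ) ^ 2) * (2 * N + s / (2 * N))) ≤ w (s / 2) := by
    set a := 64 / s + 8 / (M : ℝ) ^ 2 with ha
    have ha0 : 0 ≤ a := by positivity
    -- Since `e ≤ -2 Φ' + 1 / N`, the loss `4 a e` of `w` is compensated by `-8 a Φ` and the linear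
    -- term.
    have := monotoneOn_of_hasDerivAt_nonneg
      (φ := fun r => w r - 8 * a * Φ r + 4 * a / N * r)
      (φ' := fun r => w' r - 8 * a * Φ' r + 4 * a / N * 1) (a := 0) (b := s / 2)
      (fun r _ => ((hwd r).sub ((hΦd r).const_mul _)).add ((hasDerivAt_id r).const_mul _))
      (fun r hr => by
        have h1 := hw1 r ⟨hr.1, by linarith [hr.2]⟩
        have h2 : 32 / (1 + (s - r)) + 8 / (M : ℝ) ^ 2 ≤ a := by
          have : 32 / (1 + (s - r)) ≤ 64 / s := by
            rw [div_le_div_iff₀ (by linarith [hr.2]) hs]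
            linarith [hr.2]
          linarith
        have h3 := mul_le_mul_of_nonneg_right h2 (he0 r)
        have h4 := mul_le_mul_of_nonneg_left (hΦle r) ha0
        have h5 : a * (-(e r / 2) + 1 / N / 2) = -(a * e r) / 2 + (4 * a / N) / 8 := by ring
        rw [h5] at h4
        linarith) ⟨le_rfl, hs2.le⟩ ⟨hs2.le, le_rfl⟩ hs2.le
    simp only [mul_zero, add_zero] at this
    have h3 := mul_nonneg ha0 (hΦ0 (s / 2))
    have h4 := mul_le_mul_of_nonneg_left (show Φ 0 ≤ N from hl0) ha0
    have h5 : 4 * (a * (2 * N + s / (2 * N))) = 8 * (a * N) + 4 * a / N * (s / 2) := by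
      field_simp; ring
    rw [h5]
    linarith
  -- the second half
  have hsecond : w (s / 2) - 4 * ((4 * N / s + 1 / N)
      * (32 * Real.log (1 + s / 2) + 4 * s / (M : ℝ) ^ 2)) ≤ w s := by
    set E := 4 * N / s + 1 / N with hEdef
    have hE0 : 0 ≤ E := by positivity
    have hlog : ∀ r ∈ Set.Icc (s / 2) s, HasDerivAt (fun r => Real.log (1 + (s - r)))
        (-1 / (1 + (s - r))) r := fun r hr => by
      have h1 : HasDerivAt (fun r => 1 + (s - r)) (-1) r :=
        ((hasDerivAt_id r).const_sub s).const_add 1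
      exact h1.log (by linarith [hr.2])
    -- The logarithm and the linear term integrate `4 q ^ 2 * E` exactly.
    have := monotoneOn_of_hasDerivAt_nonneg
      (φ := fun r => w r - 128 * E * Real.log (1 + (s - r)) + 32 * E / (M : ℝ) ^ 2 * r)
      (φ' := fun r => w' r - 128 * E * (-1 / (1 + (s - r))) + 32 * E / (M : ℝ) ^ 2 * 1)
      (a := s / 2) (b := s)
      (fun r hr => ((hwd r).sub ((hlog r hr).const_mul _)).add ((hasDerivAt_id r).const_mul _))
      (fun r hr => by
        have h1 := hw1 r ⟨by linarith [hr.1], hr.2⟩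
        have h2 : e r ≤ E := (heanti _ _ hr.1).trans hE
        have hsr : 0 ≤ s - r := sub_nonneg.2 hr.2
        have h3 := mul_le_mul_of_nonneg_left h2
          (show 0 ≤ 4 * (32 / (1 + (s - r)) + 8 / (M : ℝ) ^ 2) by positivity)
        have h4 : 4 * (32 / (1 + (s - r)) + 8 / (M : ℝ) ^ 2) * E
            = - (128 * E * (-1 / (1 + (s - r)))) + 32 * E / (M : ℝ) ^ 2 * 1 := by ring
        linarith) ⟨le_rfl, by linarith⟩ ⟨by linarith, le_rfl⟩ (by linarith)
    simp only [sub_self, add_zero, Real.log_one, mul_zero, sub_zero, sub_half] at this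
    have h5 : 4 * (E * (32 * Real.log (1 + s / 2) + 4 * s / (M : ℝ) ^ 2))
        = 128 * E * Real.log (1 + s / 2) + 32 * E / (M : ℝ) ^ 2 * s
          - 32 * E / (M : ℝ) ^ 2 * (s / 2) := by ring
    rw [h5]
    linarith
  have hup : w s ≤ w 0 := by
    have := monotoneOn_of_hasDerivAt_nonneg (φ := fun r => -w r) (a := 0) (b := s)
      (fun r _ => (hwd r).neg) (fun r hr => by linarith [hw0 r hr])
      ⟨le_rfl, hs.le⟩ ⟨hs.le, le_rfl⟩ hs.le
    simpa using this
  have hws : w s = K s (Sum.inl x, Sum.inl y) := by simp [hw, flow_zero]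
  have hw00 : w 0 = flow (pairGen (rate N M)) s (K 0) (Sum.inl x, Sum.inl y) := by simp [hw]
  rw [← hws, ← hw00]
  have hnn : 0 ≤ sourceBound N M s := by
    unfold sourceBound
    have : 0 ≤ Real.log (1 + s / 2) := Real.log_nonneg (by linarith)
    positivity
  rw [abs_le]
  constructor
  · rw [sourceBound, mul_add]; linarith
  · linarith

/-- The decay of the initial correlations. -/
lemma abs_flow_pairGen_le (hM : 0 < M) {k : Vertex N M → Vertex N M → ℝ} {κ β : ℝ}
    (hβ : 0 ≤ β)
    (hk : ∀ a b, a ≠ b → |k a b| ≤ κ + β * (channel N M a + channel N M b))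
    {s : ℝ} (hs : 0 < s) {x y : Site N} (hxy : x ≠ y) :
    |flow (pairGen (rate N M)) s (offDiag k) (Sum.inl x, Sum.inl y)|
      ≤ κ + β * (2 * (N / M) + ((x : ℝ) * (N + 1 - x) + (y : ℝ) * (N + 1 - y)) / s) := by
  have hne : (Sum.inl x : Vertex N M) ≠ Sum.inl y := fun h => hxy (Sum.inl.inj h)
  -- A majorant whose evolution reduces to one walker: constants are preserved, and sums evolve as
  -- without exclusion.
  set B : Vertex N M × Vertex N M → ℝ := offDiag (fun _ _ => κ)
    + β • offDiag (fun a b => channel N M a + channel N M b) with hB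
  have hflow : flow (pairGen (rate N M)) s B (Sum.inl x, Sum.inl y)
      ≤ κ + β * (2 * (N / M) + ((x : ℝ) * (N + 1 - x) + (y : ℝ) * (N + 1 - y)) / s) := by
    rw [hB, map_add, map_smul, flow_pairGen_const rate_nonneg _ hs.le,
      flow_pairGen_add rate_nonneg rate_symm _ hs.le]
    simp only [Pi.add_apply, Pi.smul_apply, smul_eq_mul, offDiag_of_ne _ hne]
    have h1 := flow_channel_le hM x hs
    have h2 := flow_channel_le hM y hs
    rw [add_div]
    exact add_le_add le_rfl (mul_le_mul_of_nonneg_left (by linarith) hβ)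
  have h1 : offDiag k ≤ B := by
    rintro ⟨a, b⟩
    by_cases hab : a = b
    · subst hab; simp [hB, offDiag_self]
    · simp only [hB, Pi.add_apply, Pi.smul_apply, smul_eq_mul, offDiag_of_ne _ hab]
      exact le_of_abs_le (hk a b hab)
  have h2 : -B ≤ offDiag k := by
    rintro ⟨a, b⟩
    by_cases hab : a = b
    · subst hab; simp [hB, offDiag_self]
    · simp only [hB, Pi.neg_apply, Pi.add_apply, Pi.smul_apply, smul_eq_mul, offDiag_of_ne _ hab]
      exact neg_le_of_abs_le (hk a b hab)
  have h3 := flow_mono (isMetzler_pairGen rate_nonneg) hs.le h1 (Sum.inl x, Sum.inl y)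
  have h4 := flow_mono (isMetzler_pairGen rate_nonneg) hs.le h2 (Sum.inl x, Sum.inl y)
  rw [map_neg, Pi.neg_apply] at h4
  rw [abs_le]
  constructor <;> linarith

end Correlation

/-! ### Duality in the bulk -/

section Duality

variable {N M : ℕ}

/-- The occupation of a site of the channel, or the density of the reservoir of a vertex. -/
def density : Vertex N M → Config N M → ℝ
  | Sum.inl x => fun ω => occ (ω.1 x)
  | Sum.inr (Sum.inl _) => leftDensity
  | Sum.inr (Sum.inr _) => rightDensity

/-- The probability that two distinct sites of a reservoir with `n` particles are occupied. -/
def pairDensity (n : Fin (M + 1)) : ℝ := (n : ℕ) * ((n : ℕ) - 1) / ((M : ℝ) * (M - 1))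

/-- The probability that two distinct vertices are occupied, given the configuration. -/
def density₂ : Vertex N M → Vertex N M → Config N M → ℝ
  | Sum.inr (Sum.inl _), Sum.inr (Sum.inl _) => fun ω => pairDensity ω.2.1
  | Sum.inr (Sum.inr _), Sum.inr (Sum.inr _) => fun ω => pairDensity ω.2.2
  | v, w => fun ω => density v ω * density w ω

lemma density₂_symm (v w : Vertex N M) : density₂ v w = density₂ w v := by
  rcases v with x | i | i <;> rcases w with y | j | j <;> funext ω <;>
    simp only [density₂] <;> ring

/-- The action of the pair generator off the diagonal. -/
def pairSum (c : Vertex N M → Vertex N M → ℝ) (F : Vertex N M → Vertex N M → ℝ)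
    (v w : Vertex N M) : ℝ :=
  ∑ u, c v u * (F u w - F v w) - c v w * (F w w - F v w)
    + (∑ u, c w u * (F v u - F v w) - c w v * (F v v - F v w))

lemma pairSum_symm (c : Vertex N M → Vertex N M → ℝ) {F : Vertex N M → Vertex N M → ℝ}
    (hF : ∀ v w, F v w = F w v) (v w : Vertex N M) : pairSum c F v w = pairSum c F w v := by
  unfold pairSum
  simp only [hF _ w]
  simp only [hF v]
  ring

/-- The part of the stirring rates which belongs to the channel. -/
def bulkRate : Vertex N M → Vertex N M → ℝ
  | Sum.inl x, Sum.inl y => (if (y : ℕ) = x + 1 then 1 / 2 else 0)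
      + (if (x : ℕ) = y + 1 then 1 / 2 else 0)
  | _, _ => 0

/-- The part of the stirring rates which belongs to the left reservoir. -/
def leftRate : Vertex N M → Vertex N M → ℝ
  | Sum.inl x, Sum.inr (Sum.inl _) => if (x : ℕ) = 1 then 1 / (2 * M) else 0
  | Sum.inr (Sum.inl _), Sum.inl x => if (x : ℕ) = 1 then 1 / (2 * M) else 0
  | _, _ => 0

/-- The part of the stirring rates which belongs to the right reservoir. -/
def rightRate : Vertex N M → Vertex N M → ℝ
  | Sum.inl x, Sum.inr (Sum.inr _) => if (x : ℕ) = N then 1 / (2 * M) else 0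
  | Sum.inr (Sum.inr _), Sum.inl x => if (x : ℕ) = N then 1 / (2 * M) else 0
  | _, _ => 0

lemma wt_zero : wt N M 0 = 1 / M := if_pos (Or.inl rfl)

lemma wt_last : wt N M (N + 1) = 1 / M := if_pos (Or.inr rfl)

/-- The rates are split like the generator, so that duality can be verified piece by piece. For `N =
0` the two reservoirs would be adjacent. -/
lemma rate_eq (hN : 0 < N) (v w : Vertex N M) :
    rate N M v w = bulkRate v w + rightRate v w + leftRate v w := by
  have hsite : ∀ x : Site N, wt N M x = 1 := fun x => wt_of_mem x.2
  have hle : ∀ x : Site N, 1 ≤ (x : ℕ) ∧ (x : ℕ) ≤ N := fun x => Finset.mem_Icc.1 x.2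
  unfold rate
  rcases v with x | i | i <;> rcases w with y | j | j <;>
    simp only [pos, bulkRate, rightRate, leftRate, hsite, wt_zero, wt_last]
  · by_cases h1 : (y : ℕ) = x + 1
    · rw [if_pos (Or.inl h1), if_pos h1, if_neg (by omega)]; ring
    · by_cases h2 : (x : ℕ) = y + 1
      · rw [if_pos (Or.inr h2), if_neg h1, if_pos h2]; ring
      · rw [if_neg (by tauto), if_neg h1, if_neg h2]; ring
  · have := hle x
    by_cases h : (x : ℕ) = 1
    · rw [if_pos (by omega), if_pos h]; ring
    · rw [if_neg (by omega), if_neg h]; ring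
  · have := hle x
    by_cases h : (x : ℕ) = N
    · rw [if_pos (by omega), if_pos h]; ring
    · rw [if_neg (by omega), if_neg h]; ring
  · have := hle y
    by_cases h : (y : ℕ) = 1
    · rw [if_pos (by omega), if_pos h]; ring
    · rw [if_neg (by omega), if_neg h]; ring
  · rw [if_neg (by omega)]; ring
  · rw [if_neg (by omega)]; ring
  · have := hle y
    by_cases h : (y : ℕ) = N
    · rw [if_pos (by omega), if_pos h]; ring
    · rw [if_neg (by omega), if_neg h]; ring
  · rw [if_neg (by omega)]; ring
  · rw [if_neg (by omega)]; ring

/-- The part of the generator which belongs to the channel. -/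
def bulkGen (f : Config N M → ℝ) (ω : Config N M) : ℝ :=
  (1 / 2) * (∑ x : Site N, ∑ y : Site N,
      if (y : ℕ) = (x : ℕ) + 1 then f (exchange ω x y) - f ω else 0)

/-- The part of the generator which belongs to the right reservoir. -/
def rightGen (f : Config N M → ℝ) (ω : Config N M) : ℝ :=
  ∑ x : Site N, if (x : ℕ) = N then
      boundaryRate (occ (ω.1 x)) (rightDensity ω) * (f (rightMove ω x) - f ω) else 0

/-- The part of the generator which belongs to the left reservoir. -/
def leftGen (f : Config N M → ℝ) (ω : Config N M) : ℝ :=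
  ∑ x : Site N, if (x : ℕ) = 1 then
      boundaryRate (occ (ω.1 x)) (leftDensity ω) * (f (leftMove ω x) - f ω) else 0

lemma gen_apply (f : Config N M → ℝ) (ω : Config N M) :
    gen N M f ω = bulkGen f ω + rightGen f ω + leftGen f ω := rfl

lemma bulkGen_eq (f : Config N M → ℝ) (ω : Config N M) :
    bulkGen f ω = ∑ i : Site N, ∑ j : Site N,
      (if (j : ℕ) = (i : ℕ) + 1 then 1 / 2 else 0) * (f (exchange ω i j) - f ω) := by
  rw [bulkGen, Finset.mul_sum]
  refine Finset.sum_congr rfl fun i _ => ?_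
  rw [Finset.mul_sum]
  exact Finset.sum_congr rfl fun j _ => by split_ifs <;> ring

lemma bulkGen_mul_right (f g : Config N M → ℝ) (ω : Config N M)
    (hg : ∀ i j, g (exchange ω i j) = g ω) :
    bulkGen (fun ω => f ω * g ω) ω = bulkGen f ω * g ω := by
  rw [bulkGen_eq, bulkGen_eq, Finset.sum_mul]
  refine Finset.sum_congr rfl fun i _ => ?_
  rw [Finset.sum_mul]
  exact Finset.sum_congr rfl fun j _ => by rw [hg]; ring

lemma bulkGen_eq_zero (g : Config N M → ℝ) (ω : Config N M)
    (hg : ∀ i j, g (exchange ω i j) = g ω) : bulkGen g ω = 0 := by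
  simp [bulkGen_eq, hg]

lemma occ_exchange (ω : Config N M) (i j x : Site N) :
    occ ((exchange ω i j).1 x) = occ (ω.1 (Equiv.swap i j x)) := rfl

lemma swap_apply_sub {α : Type*} [DecidableEq α] (F : α → ℝ) (i j x : α) :
    F (Equiv.swap i j x) - F x =
      (if i = x then F j - F x else 0) + (if j = x then F i - F x else 0) := by
  by_cases h1 : i = x
  · subst h1
    by_cases h2 : j = i
    · subst h2; simp
    · simp [h2]
  · by_cases h2 : j = x
    · subst h2; simp [h1]
    · simp [h1, h2, Equiv.swap_apply_of_ne_of_ne (Ne.symm h1) (Ne.symm h2)]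

/-- By symmetry of `G`, exchanging `x` with `y` has no effect; the inner conditions remove these
exchanges, which are the jumps suppressed by exclusion. -/
lemma swap_apply_apply_sub {α : Type*} [DecidableEq α] (G : α → α → ℝ)
    (hG : ∀ a b, G a b = G b a) (i j : α) {x y : α} (hxy : x ≠ y) :
    G (Equiv.swap i j x) (Equiv.swap i j y) - G x y =
      (if i = x then (if j = y then 0 else G j y - G x y) else 0)
      + (if j = x then (if i = y then 0 else G i y - G x y) else 0)
      + ((if i = y then (if j = x then 0 else G x j - G x y) else 0)
      + (if j = y then (if i = x then 0 else G x i - G x y) else 0)) := by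
  by_cases h1 : i = x
  · subst h1
    by_cases h2 : j = i
    · subst h2; simp [hxy]
    · by_cases h3 : j = y
      · subst h3; simp [hG j i, hxy, h2]
      · simp [h2, h3, hxy, Equiv.swap_apply_of_ne_of_ne (Ne.symm hxy) (Ne.symm h3)]
  · by_cases h2 : i = y
    · subst h2
      by_cases h3 : j = x
      · subst h3; simp [hG i j, hxy, Ne.symm hxy]
      · by_cases h4 : j = i
        · subst h4; simp [h3]
        · simp [h1, h3, h4, Equiv.swap_apply_of_ne_of_ne (Ne.symm h1) (Ne.symm h3)]
    · by_cases h3 : j = x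
      · subst h3
        simp [h1, h2, hxy, Equiv.swap_apply_of_ne_of_ne (Ne.symm h2) (Ne.symm hxy)]
      · by_cases h4 : j = y
        · subst h4
          simp [h1, h2, h3, Equiv.swap_apply_of_ne_of_ne (Ne.symm h1) hxy]
        · simp [h1, h2, h3, h4, Equiv.swap_apply_of_ne_of_ne (Ne.symm h1) (Ne.symm h3),
            Equiv.swap_apply_of_ne_of_ne (Ne.symm h2) (Ne.symm h4)]

/-- The generator lists each bond in one orientation; both orientations at `x` combine to a
symmetric rate. -/
lemma sum_sum_mul_ite_add {α : Type*} [Fintype α] [DecidableEq α] (b : α → α → ℝ) (x : α)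
    (g : α → ℝ) :
    ∑ i, ∑ j, b i j * ((if i = x then g j else 0) + (if j = x then g i else 0))
      = ∑ u, (b x u + b u x) * g u := by
  simp only [mul_add, Finset.sum_add_distrib, mul_ite, mul_zero, add_mul]
  congr 1
  · rw [Finset.sum_comm]; simp
  · simp

lemma bulkGen_site (ω : Config N M) (x : Site N) :
    bulkGen (density (Sum.inl x)) ω = walkGen bulkRate (fun w => density w ω) (Sum.inl x) := by
  rw [bulkGen_eq, walkGen_apply, Fintype.sum_sum_type]
  simp only [density, occ_exchange, swap_apply_sub (fun z => occ (ω.1 z))]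
  rw [sum_sum_mul_ite_add (fun i j : Site N => if (j : ℕ) = i + 1 then (1 / 2 : ℝ) else 0) x
    (fun u => occ (ω.1 u) - occ (ω.1 x))]
  simp [bulkRate]

lemma bulkGen_site_site (ω : Config N M) {x y : Site N} (hxy : x ≠ y) :
    bulkGen (density₂ (Sum.inl x) (Sum.inl y)) ω
      = pairSum bulkRate (fun v w => density₂ v w ω) (Sum.inl x) (Sum.inl y) := by
  rw [bulkGen_eq]
  simp only [density₂, density, occ_exchange]
  simp only [swap_apply_apply_sub (fun a b => occ (ω.1 a) * occ (ω.1 b)) (fun a b => mul_comm _ _)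
    _ _ hxy]
  have e : ∀ x y : Site N, ∀ g : Site N → ℝ, ∑ i : Site N, ∑ j : Site N,
      (if (j : ℕ) = (i : ℕ) + 1 then 1 / 2 else 0) *
        ((if i = x then (if j = y then 0 else g j) else 0)
          + (if j = x then (if i = y then 0 else g i) else 0))
      = ∑ u : Site N, ((if (u : ℕ) = x + 1 then 1 / 2 else 0)
          + (if (x : ℕ) = u + 1 then 1 / 2 else 0)) * g u
        - ((if (y : ℕ) = x + 1 then 1 / 2 else 0)
          + (if (x : ℕ) = y + 1 then 1 / 2 else 0)) * g y := by
    intro x y g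
    rw [sum_sum_mul_ite_add (fun i j : Site N => if (j : ℕ) = i + 1 then (1 / 2 : ℝ) else 0) x
      (fun u => if u = y then 0 else g u), ← sum_ite_eq_zero_else]
    exact Finset.sum_congr rfl fun u _ => by split_ifs <;> ring
  simp only [mul_add _ (_ + _) (_ + _), Finset.sum_add_distrib (f := fun _ => _ * (_ + _))]
  simp only [Finset.sum_add_distrib (ι := Site N) (f := fun i : Site N => ∑ j : Site N, _ * (_ + _))]
  rw [e x y fun u => occ (ω.1 u) * occ (ω.1 y) - occ (ω.1 x) * occ (ω.1 y),
    e y x fun u => occ (ω.1 x) * occ (ω.1 u) - occ (ω.1 x) * occ (ω.1 y)]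
  unfold pairSum
  rw [Fintype.sum_sum_type, Fintype.sum_sum_type]
  simp [bulkRate]

end Duality

/-! ### Duality for one walker at the reservoirs -/

section DualityReservoirs

variable {N M : ℕ}

lemma bulkGen_density (v : Vertex N M) (ω : Config N M) :
    bulkGen (density v) ω = walkGen bulkRate (fun w => density w ω) v := by
  rcases v with x | z
  · exact bulkGen_site ω x
  · rw [bulkGen_eq_zero _ _ (by rcases z with i | i <;> exact fun _ _ => rfl), walkGen_apply]
    simp [bulkRate]

lemma bulkGen_density₂ {v w : Vertex N M} (hvw : v ≠ w) (ω : Config N M) :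
    bulkGen (density₂ v w) ω = pairSum bulkRate (fun v w => density₂ v w ω) v w := by
  have hres : ∀ (x : Site N) (z : Fin M ⊕ Fin M), bulkGen (density₂ (Sum.inl x) (Sum.inr z)) ω
      = pairSum bulkRate (fun v w => density₂ v w ω) (Sum.inl x) (Sum.inr z) := by
    intro x z
    have e : (density₂ (Sum.inl x) (Sum.inr z) : Config N M → ℝ)
        = fun ω => density (Sum.inl x) ω * density (Sum.inr z) ω := by
      rcases z with i | i <;> rfl
    have e2 := bulkGen_mul_right (density (Sum.inl x)) (density (Sum.inr z)) ω
      (by rcases z with i | i <;> exact fun _ _ => rfl)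
    rw [e, e2, bulkGen_site, walkGen_apply, Finset.sum_mul]
    unfold pairSum
    rw [Fintype.sum_sum_type, Fintype.sum_sum_type, Fintype.sum_sum_type]
    rcases z with i | i <;> simp [bulkRate, density₂, density] <;>
      exact Finset.sum_congr rfl fun u _ => by ring
  rcases v with x | z <;> rcases w with y | z'
  · exact bulkGen_site_site ω fun h => hvw (congrArg _ h)
  · exact hres x z'
  · rw [density₂_symm, hres y z, pairSum_symm _ fun v w => by rw [density₂_symm]]
  · rw [bulkGen_eq_zero _ _ (by rcases z with i | i <;> rcases z' with j | j <;>
      exact fun _ _ => rfl)]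
    simp [pairSum, bulkRate]

/-- The density of a reservoir with `n` particles. -/
def resDensity (n : Fin (M + 1)) : ℝ := (n : ℕ) / (M : ℝ)

section Boundary

variable (b : Bool) (n : Fin (M + 1))

lemma boundaryRate_mul_occ :
    boundaryRate (occ b) (resDensity n) * (occ (!b) - occ b) = 1 / 2 * (resDensity n - occ b) := by
  cases b <;> simp [boundaryRate, occ] <;> ring

/-- The rate vanishes wherever `reservoirMove` truncates, so the move may be taken to be exactly `n
± 1`; the case `n = 0` stays separate on account of natural subtraction. -/
lemma boundaryRate_mul_move (hM : 2 ≤ M) (g : ℕ → ℝ) :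
    boundaryRate (occ b) (resDensity n) * g (reservoirMove b n : ℕ) =
      if b then 1 / 2 * (1 - resDensity n) * g ((n : ℕ) + 1)
      else if (n : ℕ) = 0 then 0 else 1 / 2 * resDensity n * g ((n : ℕ) - 1) := by
  have hM0 : (M : ℝ) ≠ 0 := by positivity
  cases b
  · by_cases h : (n : ℕ) = 0
    · simp [boundaryRate, occ, resDensity, h]
    · simp [boundaryRate, occ, reservoirMove, h]
  · have hn := n.2
    by_cases h : (n : ℕ) = M
    · simp [boundaryRate, occ, resDensity, h, hM0]
    · have e : min ((n : ℕ) + 1) M = n + 1 := by omega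
      simp [boundaryRate, occ, reservoirMove, e]

lemma boundaryRate_mul_resDensity (hM : 2 ≤ M) :
    boundaryRate (occ b) (resDensity n) * (resDensity (reservoirMove b n) - resDensity n)
      = 1 / (2 * M) * (occ b - resDensity n) := by
  have hM0 : (M : ℝ) ≠ 0 := by positivity
  have h := boundaryRate_mul_move b n hM (fun k => (k : ℝ) / M - resDensity n)
  refine Eq.trans h ?_
  cases b
  · by_cases h : (n : ℕ) = 0
    · simp [occ, resDensity, h]
    · have e : (((n : ℕ) - 1 : ℕ) : ℝ) = (n : ℕ) - 1 := by
        rw [Nat.cast_sub (by omega)]; simp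
      simp only [occ, resDensity, h, e]
      simp
      field_simp
      ring
  · simp only [occ, resDensity]
    simp
    field_simp
    ring

/-- Two walkers in the reservoir, each leaving at rate `1 / (2M)`, give the factor `1 / M`. -/
lemma boundaryRate_mul_pairDensity (hM : 2 ≤ M) :
    boundaryRate (occ b) (resDensity n) * (pairDensity (reservoirMove b n) - pairDensity n)
      = 1 / M * (occ b * resDensity n - pairDensity n) := by
  have hM0 : (M : ℝ) ≠ 0 := by positivity
  have hM1 : (M : ℝ) - 1 ≠ 0 := by
    have : (2 : ℝ) ≤ M := by exact_mod_cast hM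
    linarith
  have h := boundaryRate_mul_move b n hM
    (fun k => (k : ℝ) * (k - 1) / ((M : ℝ) * (M - 1)) - pairDensity n)
  refine Eq.trans h ?_
  cases b
  · by_cases h : (n : ℕ) = 0
    · simp [occ, resDensity, pairDensity, h]
    · have e : (((n : ℕ) - 1 : ℕ) : ℝ) = (n : ℕ) - 1 := by
        rw [Nat.cast_sub (by omega)]; simp
      simp only [occ, resDensity, pairDensity, h, e]
      simp
      field_simp
      ring
  · simp only [occ, resDensity, pairDensity]
    simp
    field_simp
    ring

/-- The walker in the channel can jump to only `M - 1` reservoir sites, each at rate `1 / (2M)`,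
since the other walker blocks one of them. The falling factorial in `pairDensity` matches this
count. -/
lemma boundaryRate_mul_occ_mul_resDensity (hM : 2 ≤ M) :
    boundaryRate (occ b) (resDensity n) *
        (occ (!b) * resDensity (reservoirMove b n) - occ b * resDensity n)
      = 1 / 2 * (1 - 1 / M) * (pairDensity n - occ b * resDensity n) := by
  have hM0 : (M : ℝ) ≠ 0 := by positivity
  have hM1 : (M : ℝ) - 1 ≠ 0 := by
    have : (2 : ℝ) ≤ M := by exact_mod_cast hM
    linarith
  have h := boundaryRate_mul_move b n hM
    (fun k => occ (!b) * ((k : ℝ) / M) - occ b * resDensity n)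
  refine Eq.trans h ?_
  cases b
  · by_cases h : (n : ℕ) = 0
    · simp [occ, resDensity, pairDensity, h]
    · have e : (((n : ℕ) - 1 : ℕ) : ℝ) = (n : ℕ) - 1 := by
        rw [Nat.cast_sub (by omega)]; simp
      simp only [occ, resDensity, pairDensity, h, e]
      simp
      field_simp
  · simp only [occ, resDensity, pairDensity]
    simp
    field_simp
    ring

end Boundary

lemma leftDensity_eq (ω : Config N M) : leftDensity ω = resDensity ω.2.1 := rfl

lemma rightDensity_eq (ω : Config N M) : rightDensity ω = resDensity ω.2.2 := rfl

lemma leftGen_eq (a : Site N) (ha : (a : ℕ) = 1) (f : Config N M → ℝ) (ω : Config N M) :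
    leftGen f ω = boundaryRate (occ (ω.1 a)) (resDensity ω.2.1) * (f (leftMove ω a) - f ω) := by
  have h : ∀ x : Site N, (x : ℕ) = 1 ↔ x = a := fun x =>
    ⟨fun h => Subtype.ext (h.trans ha.symm), fun h => h ▸ ha⟩
  simp only [leftGen, h, leftDensity_eq]
  simp

lemma rightGen_eq (a : Site N) (ha : (a : ℕ) = N) (f : Config N M → ℝ) (ω : Config N M) :
    rightGen f ω = boundaryRate (occ (ω.1 a)) (resDensity ω.2.2) * (f (rightMove ω a) - f ω) := by
  have h : ∀ x : Site N, (x : ℕ) = N ↔ x = a := fun x =>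
    ⟨fun h => Subtype.ext (h.trans ha.symm), fun h => h ▸ ha⟩
  simp only [rightGen, h, rightDensity_eq]
  simp

lemma occ_update (η : Site N → Bool) (a x : Site N) (b : Bool) :
    occ (Function.update η a b x) = if x = a then occ b else occ (η x) := by
  by_cases h : x = a
  · subst h; simp
  · simp [h]

lemma leftGen_density (hN : 0 < N) (hM : 2 ≤ M) (v : Vertex N M) (ω : Config N M) :
    leftGen (density v) ω = walkGen leftRate (fun w => density w ω) v := by
  set a : Site N := ⟨1, Finset.mem_Icc.2 ⟨le_rfl, hN⟩⟩ with ha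
  have h : ∀ x : Site N, (x : ℕ) = 1 ↔ x = a := fun x => by rw [Subtype.ext_iff]
  have hM0 : (M : ℝ) ≠ 0 := by positivity
  have h1 := boundaryRate_mul_occ (ω.1 a) ω.2.1
  have h2 := boundaryRate_mul_resDensity (ω.1 a) ω.2.1 hM
  rw [leftGen_eq a rfl, walkGen_apply, Fintype.sum_sum_type, Fintype.sum_sum_type]
  rcases v with x | i | i
  · by_cases hx : x = a
    · subst hx
      simp only [density, leftMove, occ_update, leftDensity_eq, leftRate, h]
      simp only [if_true, h1]
      simp
      field_simp
    · simp [density, leftMove, leftRate, h, hx]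
  · simp only [density, leftMove, leftDensity_eq, leftRate, h, h2]
    simp
  · simp [density, leftMove, rightDensity, leftRate]

lemma rightGen_density (hN : 0 < N) (hM : 2 ≤ M) (v : Vertex N M) (ω : Config N M) :
    rightGen (density v) ω = walkGen rightRate (fun w => density w ω) v := by
  set a : Site N := ⟨N, Finset.mem_Icc.2 ⟨hN, le_rfl⟩⟩ with ha
  have h : ∀ x : Site N, (x : ℕ) = N ↔ x = a := fun x => by rw [Subtype.ext_iff]
  have hM0 : (M : ℝ) ≠ 0 := by positivity
  have h1 := boundaryRate_mul_occ (ω.1 a) ω.2.2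
  have h2 := boundaryRate_mul_resDensity (ω.1 a) ω.2.2 hM
  rw [rightGen_eq a rfl, walkGen_apply, Fintype.sum_sum_type, Fintype.sum_sum_type]
  rcases v with x | i | i
  · by_cases hx : x = a
    · subst hx
      simp only [density, rightMove, occ_update, rightDensity_eq, rightRate, h]
      simp only [if_true, h1]
      simp
      field_simp
    · simp [density, rightMove, rightRate, h, hx]
  · simp [density, rightMove, leftDensity, rightRate]
  · simp only [density, rightMove, rightDensity_eq, rightRate, h, h2]
    simp

end DualityReservoirs

/-! ### Duality for two walkers at the reservoirs -/

section DualityPairs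

variable {N M : ℕ}

lemma leftGen_density₂_site_site (hN : 0 < N) (hM : 2 ≤ M) {x y : Site N} (hxy : x ≠ y)
    (ω : Config N M) :
    leftGen (density₂ (Sum.inl x) (Sum.inl y)) ω
      = pairSum leftRate (fun v w => density₂ v w ω) (Sum.inl x) (Sum.inl y) := by
  set a : Site N := ⟨1, Finset.mem_Icc.2 ⟨le_rfl, hN⟩⟩ with ha
  have h : ∀ x : Site N, (x : ℕ) = 1 ↔ x = a := fun x => by rw [Subtype.ext_iff]
  have hM0 : (M : ℝ) ≠ 0 := by positivity
  have h1 := boundaryRate_mul_occ (ω.1 a) ω.2.1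
  rw [leftGen_eq a rfl, pairSum, Fintype.sum_sum_type, Fintype.sum_sum_type,
    Fintype.sum_sum_type, Fintype.sum_sum_type]
  simp only [density₂, density, leftMove, occ_update, leftRate, h, leftDensity_eq]
  by_cases hx : x = a
  · have hy : y ≠ a := fun e => hxy (hx.trans e.symm)
    subst hx
    simp only [if_true, if_neg hy, ← sub_mul, ← mul_assoc, h1]
    simp
    field_simp
  · by_cases hy : y = a
    · subst hy
      simp only [if_true, if_neg hx, ← mul_sub]
      rw [mul_left_comm, h1]
      simp
      field_simp
    · simp [hx, hy]

lemma leftGen_density₂_site_left (hN : 0 < N) (hM : 2 ≤ M) (x : Site N) (i : Fin M)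
    (ω : Config N M) :
    leftGen (density₂ (Sum.inl x) (Sum.inr (Sum.inl i))) ω
      = pairSum leftRate (fun v w => density₂ v w ω) (Sum.inl x) (Sum.inr (Sum.inl i)) := by
  set a : Site N := ⟨1, Finset.mem_Icc.2 ⟨le_rfl, hN⟩⟩ with ha
  have h : ∀ x : Site N, (x : ℕ) = 1 ↔ x = a := fun x => by rw [Subtype.ext_iff]
  have hM0 : (M : ℝ) ≠ 0 := by positivity
  have h2 := boundaryRate_mul_resDensity (ω.1 a) ω.2.1 hM
  have h3 := boundaryRate_mul_occ_mul_resDensity (ω.1 a) ω.2.1 hM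
  rw [leftGen_eq a rfl, pairSum, Fintype.sum_sum_type, Fintype.sum_sum_type,
    Fintype.sum_sum_type, Fintype.sum_sum_type]
  simp only [density₂, density, leftMove, occ_update, leftRate, h, leftDensity_eq]
  by_cases hx : x = a
  · subst hx
    simp only [if_true, h3]
    simp
    field_simp
  · simp only [if_neg hx, ← mul_sub]
    rw [mul_left_comm, h2]
    simp
    ring

lemma leftGen_density₂_site_right (hN : 0 < N) (hM : 2 ≤ M) (x : Site N) (i : Fin M)
    (ω : Config N M) :
    leftGen (density₂ (Sum.inl x) (Sum.inr (Sum.inr i))) ω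
      = pairSum leftRate (fun v w => density₂ v w ω) (Sum.inl x) (Sum.inr (Sum.inr i)) := by
  set a : Site N := ⟨1, Finset.mem_Icc.2 ⟨le_rfl, hN⟩⟩ with ha
  have h : ∀ x : Site N, (x : ℕ) = 1 ↔ x = a := fun x => by rw [Subtype.ext_iff]
  have hM0 : (M : ℝ) ≠ 0 := by positivity
  have h1 := boundaryRate_mul_occ (ω.1 a) ω.2.1
  rw [leftGen_eq a rfl, pairSum, Fintype.sum_sum_type, Fintype.sum_sum_type,
    Fintype.sum_sum_type, Fintype.sum_sum_type]
  simp only [density₂, density, leftMove, occ_update, leftRate, h, leftDensity_eq, rightDensity_eq]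
  by_cases hx : x = a
  · subst hx
    simp only [if_true, ← sub_mul, ← mul_assoc, h1]
    simp
    field_simp
  · simp [hx]

lemma leftGen_density₂_left_left (hN : 0 < N) (hM : 2 ≤ M) (i j : Fin M) (ω : Config N M) :
    leftGen (density₂ (Sum.inr (Sum.inl i)) (Sum.inr (Sum.inl j))) ω
      = pairSum leftRate (fun v w => density₂ v w ω) (Sum.inr (Sum.inl i)) (Sum.inr (Sum.inl j)) := by
  set a : Site N := ⟨1, Finset.mem_Icc.2 ⟨le_rfl, hN⟩⟩ with ha
  have h : ∀ x : Site N, (x : ℕ) = 1 ↔ x = a := fun x => by rw [Subtype.ext_iff]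
  have hM0 : (M : ℝ) ≠ 0 := by positivity
  have h3 := boundaryRate_mul_pairDensity (ω.1 a) ω.2.1 hM
  rw [leftGen_eq a rfl, pairSum, Fintype.sum_sum_type, Fintype.sum_sum_type,
    Fintype.sum_sum_type, Fintype.sum_sum_type]
  simp only [density₂, density, leftMove, leftRate, h, leftDensity_eq, h3]
  simp
  field_simp
  ring

lemma leftGen_density₂_left_right (hN : 0 < N) (hM : 2 ≤ M) (i j : Fin M) (ω : Config N M) :
    leftGen (density₂ (Sum.inr (Sum.inl i)) (Sum.inr (Sum.inr j))) ω
      = pairSum leftRate (fun v w => density₂ v w ω) (Sum.inr (Sum.inl i)) (Sum.inr (Sum.inr j)) := by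
  set a : Site N := ⟨1, Finset.mem_Icc.2 ⟨le_rfl, hN⟩⟩ with ha
  have h : ∀ x : Site N, (x : ℕ) = 1 ↔ x = a := fun x => by rw [Subtype.ext_iff]
  have h2 := boundaryRate_mul_resDensity (ω.1 a) ω.2.1 hM
  rw [leftGen_eq a rfl, pairSum, Fintype.sum_sum_type, Fintype.sum_sum_type,
    Fintype.sum_sum_type, Fintype.sum_sum_type]
  simp only [density₂, density, leftMove, leftRate, h, leftDensity_eq, rightDensity_eq]
  simp only [← sub_mul, ← mul_assoc, h2]
  simp

lemma leftGen_density₂ (hN : 0 < N) (hM : 2 ≤ M) {v w : Vertex N M} (hvw : v ≠ w)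
    (ω : Config N M) :
    leftGen (density₂ v w) ω = pairSum leftRate (fun v w => density₂ v w ω) v w := by
  have hs : ∀ v w : Vertex N M, density₂ v w ω = density₂ w v ω := fun v w => by
    rw [density₂_symm]
  rcases v with x | i | i <;> rcases w with y | j | j
  · exact leftGen_density₂_site_site hN hM (fun h => hvw (congrArg _ h)) ω
  · exact leftGen_density₂_site_left hN hM x j ω
  · exact leftGen_density₂_site_right hN hM x j ω
  · rw [density₂_symm, leftGen_density₂_site_left hN hM, pairSum_symm _ hs]
  · exact leftGen_density₂_left_left hN hM i j ω
  · exact leftGen_density₂_left_right hN hM i j ω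
  · rw [density₂_symm, leftGen_density₂_site_right hN hM, pairSum_symm _ hs]
  · rw [density₂_symm, leftGen_density₂_left_right hN hM, pairSum_symm _ hs]
  -- Two walkers in the right reservoir do not interact with the left one: both sides vanish.
  · simp [leftGen, pairSum, leftRate, density₂, leftMove]

lemma rightGen_density₂_site_site (hN : 0 < N) (hM : 2 ≤ M) {x y : Site N} (hxy : x ≠ y)
    (ω : Config N M) :
    rightGen (density₂ (Sum.inl x) (Sum.inl y)) ω
      = pairSum rightRate (fun v w => density₂ v w ω) (Sum.inl x) (Sum.inl y) := by
  set a : Site N := ⟨N, Finset.mem_Icc.2 ⟨hN, le_rfl⟩⟩ with ha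
  have h : ∀ x : Site N, (x : ℕ) = N ↔ x = a := fun x => by rw [Subtype.ext_iff]
  have hM0 : (M : ℝ) ≠ 0 := by positivity
  have h1 := boundaryRate_mul_occ (ω.1 a) ω.2.2
  rw [rightGen_eq a rfl, pairSum, Fintype.sum_sum_type, Fintype.sum_sum_type,
    Fintype.sum_sum_type, Fintype.sum_sum_type]
  simp only [density₂, density, rightMove, occ_update, rightRate, h, rightDensity_eq]
  by_cases hx : x = a
  · have hy : y ≠ a := fun e => hxy (hx.trans e.symm)
    subst hx
    simp only [if_true, if_neg hy, ← sub_mul, ← mul_assoc, h1]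
    simp
    field_simp
  · by_cases hy : y = a
    · subst hy
      simp only [if_true, if_neg hx, ← mul_sub]
      rw [mul_left_comm, h1]
      simp
      field_simp
    · simp [hx, hy]

lemma rightGen_density₂_site_right (hN : 0 < N) (hM : 2 ≤ M) (x : Site N) (i : Fin M)
    (ω : Config N M) :
    rightGen (density₂ (Sum.inl x) (Sum.inr (Sum.inr i))) ω
      = pairSum rightRate (fun v w => density₂ v w ω) (Sum.inl x) (Sum.inr (Sum.inr i)) := by
  set a : Site N := ⟨N, Finset.mem_Icc.2 ⟨hN, le_rfl⟩⟩ with ha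
  have h : ∀ x : Site N, (x : ℕ) = N ↔ x = a := fun x => by rw [Subtype.ext_iff]
  have hM0 : (M : ℝ) ≠ 0 := by positivity
  have h2 := boundaryRate_mul_resDensity (ω.1 a) ω.2.2 hM
  have h3 := boundaryRate_mul_occ_mul_resDensity (ω.1 a) ω.2.2 hM
  rw [rightGen_eq a rfl, pairSum, Fintype.sum_sum_type, Fintype.sum_sum_type,
    Fintype.sum_sum_type, Fintype.sum_sum_type]
  simp only [density₂, density, rightMove, occ_update, rightRate, h, rightDensity_eq]
  by_cases hx : x = a
  · subst hx
    simp only [if_true, h3]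
    simp
    field_simp
  · simp only [if_neg hx, ← mul_sub]
    rw [mul_left_comm, h2]
    simp
    ring

lemma rightGen_density₂_site_left (hN : 0 < N) (hM : 2 ≤ M) (x : Site N) (i : Fin M)
    (ω : Config N M) :
    rightGen (density₂ (Sum.inl x) (Sum.inr (Sum.inl i))) ω
      = pairSum rightRate (fun v w => density₂ v w ω) (Sum.inl x) (Sum.inr (Sum.inl i)) := by
  set a : Site N := ⟨N, Finset.mem_Icc.2 ⟨hN, le_rfl⟩⟩ with ha
  have h : ∀ x : Site N, (x : ℕ) = N ↔ x = a := fun x => by rw [Subtype.ext_iff]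
  have hM0 : (M : ℝ) ≠ 0 := by positivity
  have h1 := boundaryRate_mul_occ (ω.1 a) ω.2.2
  rw [rightGen_eq a rfl, pairSum, Fintype.sum_sum_type, Fintype.sum_sum_type,
    Fintype.sum_sum_type, Fintype.sum_sum_type]
  simp only [density₂, density, rightMove, occ_update, rightRate, h, leftDensity_eq,
    rightDensity_eq]
  by_cases hx : x = a
  · subst hx
    simp only [if_true, ← sub_mul, ← mul_assoc, h1]
    simp
    field_simp
  · simp [hx]

lemma rightGen_density₂_right_right (hN : 0 < N) (hM : 2 ≤ M) (i j : Fin M) (ω : Config N M) :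
    rightGen (density₂ (Sum.inr (Sum.inr i)) (Sum.inr (Sum.inr j))) ω
      = pairSum rightRate (fun v w => density₂ v w ω)
        (Sum.inr (Sum.inr i)) (Sum.inr (Sum.inr j)) := by
  set a : Site N := ⟨N, Finset.mem_Icc.2 ⟨hN, le_rfl⟩⟩ with ha
  have h : ∀ x : Site N, (x : ℕ) = N ↔ x = a := fun x => by rw [Subtype.ext_iff]
  have hM0 : (M : ℝ) ≠ 0 := by positivity
  have h3 := boundaryRate_mul_pairDensity (ω.1 a) ω.2.2 hM
  rw [rightGen_eq a rfl, pairSum, Fintype.sum_sum_type, Fintype.sum_sum_type,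
    Fintype.sum_sum_type, Fintype.sum_sum_type]
  simp only [density₂, density, rightMove, rightRate, h, rightDensity_eq, h3]
  simp
  field_simp
  ring

lemma rightGen_density₂_left_right (hN : 0 < N) (hM : 2 ≤ M) (i j : Fin M) (ω : Config N M) :
    rightGen (density₂ (Sum.inr (Sum.inl i)) (Sum.inr (Sum.inr j))) ω
      = pairSum rightRate (fun v w => density₂ v w ω)
        (Sum.inr (Sum.inl i)) (Sum.inr (Sum.inr j)) := by
  set a : Site N := ⟨N, Finset.mem_Icc.2 ⟨hN, le_rfl⟩⟩ with ha
  have h : ∀ x : Site N, (x : ℕ) = N ↔ x = a := fun x => by rw [Subtype.ext_iff]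
  have h2 := boundaryRate_mul_resDensity (ω.1 a) ω.2.2 hM
  rw [rightGen_eq a rfl, pairSum, Fintype.sum_sum_type, Fintype.sum_sum_type,
    Fintype.sum_sum_type, Fintype.sum_sum_type]
  simp only [density₂, density, rightMove, rightRate, h, leftDensity_eq, rightDensity_eq]
  simp only [← mul_sub]
  rw [mul_left_comm, h2]
  simp
  ring

lemma rightGen_density₂ (hN : 0 < N) (hM : 2 ≤ M) {v w : Vertex N M} (hvw : v ≠ w)
    (ω : Config N M) :
    rightGen (density₂ v w) ω = pairSum rightRate (fun v w => density₂ v w ω) v w := by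
  have hs : ∀ v w : Vertex N M, density₂ v w ω = density₂ w v ω := fun v w => by
    rw [density₂_symm]
  rcases v with x | i | i <;> rcases w with y | j | j
  · exact rightGen_density₂_site_site hN hM (fun h => hvw (congrArg _ h)) ω
  · exact rightGen_density₂_site_left hN hM x j ω
  · exact rightGen_density₂_site_right hN hM x j ω
  · rw [density₂_symm, rightGen_density₂_site_left hN hM, pairSum_symm _ hs]
  · simp [rightGen, pairSum, rightRate, density₂, rightMove]
  · exact rightGen_density₂_left_right hN hM i j ω
  · rw [density₂_symm, rightGen_density₂_site_right hN hM, pairSum_symm _ hs]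
  · rw [density₂_symm, rightGen_density₂_left_right hN hM, pairSum_symm _ hs]
  · exact rightGen_density₂_right_right hN hM i j ω

lemma walkGen_rate_eq (hN : 0 < N) (f : Vertex N M → ℝ) (v : Vertex N M) :
    walkGen (rate N M) f v
      = walkGen bulkRate f v + walkGen rightRate f v + walkGen leftRate f v := by
  simp only [walkGen_apply, rate_eq hN, ← Finset.sum_add_distrib]
  exact Finset.sum_congr rfl fun w _ => by ring

lemma pairSum_rate_eq (hN : 0 < N) (F : Vertex N M → Vertex N M → ℝ) (v w : Vertex N M) :
    pairSum (rate N M) F v w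
      = pairSum bulkRate F v w + pairSum rightRate F v w + pairSum leftRate F v w := by
  simp only [pairSum, rate_eq hN, add_mul, Finset.sum_add_distrib]
  ring

/-- Duality with a single walker. -/
lemma gen_density (hN : 0 < N) (hM : 2 ≤ M) (v : Vertex N M) :
    gen N M (density v) = fun ω => walkGen (rate N M) (fun w => density w ω) v := by
  funext ω
  rw [gen_apply, walkGen_rate_eq hN, bulkGen_density, rightGen_density hN hM,
    leftGen_density hN hM]

/-- Duality with two walkers with exclusion. -/
lemma gen_density₂ (hN : 0 < N) (hM : 2 ≤ M) {v w : Vertex N M} (hvw : v ≠ w) :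
    gen N M (density₂ v w)
      = fun ω => pairGen (rate N M) (offDiag fun a b => density₂ a b ω) (v, w) := by
  funext ω
  rw [gen_apply, pairGen_offDiag_apply _ _ hvw, bulkGen_density₂ hvw,
    rightGen_density₂ hN hM hvw, leftGen_density₂ hN hM hvw, ← pairSum_rate_eq hN]
  rfl

end DualityPairs

/-! ### Evolution of the correlations and their initial values -/

section Expectation

variable {N M : ℕ}

/-- The expectation at time `s` as a linear functional. -/
def expectLin (μ : Config N M → ℝ) (s : ℝ) : (Config N M → ℝ) →ₗ[ℝ] ℝ where
  toFun f := expect μ s f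
  map_add' f g := by
    simp only [expect, map_add, Pi.add_apply, mul_add, Finset.sum_add_distrib]
  map_smul' a f := by
    simp only [expect, map_smul, Pi.smul_apply, smul_eq_mul, RingHom.id_apply, Finset.mul_sum]
    exact Finset.sum_congr rfl fun ω _ => by ring

lemma hasDerivAt_expect (μ : Config N M → ℝ) (f : Config N M → ℝ) (s : ℝ) :
    HasDerivAt (fun s => expect μ s f) (expect μ s (gen N M f)) s := by
  -- `semigroup` is by definition the `flow` of `gen`.
  have h : HasDerivAt (fun s => ∑ ω, μ ω * flow (gen N M) s f ω)
      (∑ ω, μ ω * gen N M (flow (gen N M) s f) ω) s :=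
    HasDerivAt.fun_sum fun ω _ =>
      (hasDerivAt_pi.1 (hasDerivAt_flow_apply (gen N M) f s) ω).const_mul (μ ω)
  rw [← flow_commute] at h
  exact h

lemma expect_zero (μ : Config N M → ℝ) (f : Config N M → ℝ) :
    expect μ 0 f = ∑ ω, μ ω * f ω := by
  have h : semigroup N M 0 = 1 := flow_zero (gen N M)
  simp [expect, h]

/-- The expected densities at the vertices. -/
def meanDensity (μ : Config N M → ℝ) (s : ℝ) (v : Vertex N M) : ℝ := expect μ s (density v)

/-- The correlations of pairs of vertices. -/
def pairCorrelation (μ : Config N M → ℝ) (s : ℝ) : Vertex N M × Vertex N M → ℝ :=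
  offDiag fun a b => expect μ s (density₂ a b) - meanDensity μ s a * meanDensity μ s b

lemma hasDerivAt_meanDensity (hN : 0 < N) (hM : 2 ≤ M) (μ : Config N M → ℝ) (s : ℝ) :
    HasDerivAt (meanDensity μ) (walkGen (rate N M) (meanDensity μ s)) s := by
  rw [hasDerivAt_pi]
  intro v
  have h := hasDerivAt_expect μ (density v) s
  rw [gen_density hN hM] at h
  have e : (fun ω => walkGen (rate N M) (fun w => density w ω) v)
      = ∑ w, rate N M v w • (density w - density v) := by
    funext ω
    simp [walkGen_apply]
  have e2 : expect μ s (fun ω => walkGen (rate N M) (fun w => density w ω) v)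
      = walkGen (rate N M) (meanDensity μ s) v := by
    change expectLin μ s _ = _
    rw [e, map_sum]
    simp only [map_smul, map_sub]
    rfl
  rw [← e2]
  exact h

lemma expect_pairGen (μ : Config N M → ℝ) (s : ℝ) {v w : Vertex N M} (hvw : v ≠ w) :
    expect μ s (fun ω => pairGen (rate N M) (offDiag fun a b => density₂ a b ω) (v, w))
      = pairGen (rate N M) (offDiag fun a b => expect μ s (density₂ a b)) (v, w) := by
  have e : (fun ω => pairGen (rate N M) (offDiag fun a b => density₂ a b ω) (v, w))
      = ∑ u, rate N M v u • (density₂ u w - density₂ v w)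
        - rate N M v w • (density₂ w w - density₂ v w)
        + (∑ u, rate N M w u • (density₂ v u - density₂ v w)
          - rate N M w v • (density₂ v v - density₂ v w)) := by
    funext ω
    rw [pairGen_offDiag_apply _ _ hvw]
    simp only [Pi.add_apply, Pi.sub_apply, Finset.sum_apply, Pi.smul_apply, smul_eq_mul]
  change expectLin μ s _ = _
  rw [e, pairGen_offDiag_apply _ _ hvw]
  simp only [map_add, map_sub, map_sum, map_smul]
  rfl

/-- The two-point function evolves by the pair generator, while the product of the means evolves by
two free walkers; `pairGen_offDiag_mul` identifies the difference as the source. -/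
lemma hasDerivAt_pairCorrelation (hN : 0 < N) (hM : 2 ≤ M) (μ : Config N M → ℝ) (s : ℝ) :
    HasDerivAt (pairCorrelation μ) (pairGen (rate N M) (pairCorrelation μ s)
      - offDiag fun a b => rate N M a b * (meanDensity μ s a - meanDensity μ s b) ^ 2) s := by
  have hU := hasDerivAt_pi.1 (hasDerivAt_meanDensity hN hM μ s)
  have h := hasDerivAt_offDiag (V := Vertex N M)
    (F := fun r a b => expect μ r (density₂ a b) - meanDensity μ r a * meanDensity μ r b)
    (F' := fun a b => pairGen (rate N M) (offDiag fun a b => expect μ s (density₂ a b)) (a, b)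
      - (walkGen (rate N M) (meanDensity μ s) a * meanDensity μ s b
        + meanDensity μ s a * walkGen (rate N M) (meanDensity μ s) b)) (r := s)
    (fun a b hab => by
      refine HasDerivAt.sub ?_ ((hU a).mul (hU b))
      rw [← expect_pairGen μ s hab, ← gen_density₂ hN hM hab]
      exact hasDerivAt_expect μ _ s)
  refine HasDerivAt.congr_deriv h (Eq.symm ?_)
  have e : pairCorrelation μ s = (offDiag fun a b => expect μ s (density₂ a b))
      - offDiag fun a b => meanDensity μ s a * meanDensity μ s b := by
    funext p
    simp only [pairCorrelation, offDiag, Pi.sub_apply]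
    split_ifs <;> ring
  rw [e, map_sub, pairGen_offDiag_mul rate_symm]
  funext ⟨a, b⟩
  by_cases hab : a = b
  · subst hab
    simp only [Pi.sub_apply, offDiag_self, pairGen_apply_self]; ring
  · simp only [Pi.sub_apply, offDiag_of_ne _ hab]; ring

lemma eta_eq_density {x : ℕ} (hx : x ∈ Finset.Icc 1 N) :
    (eta x : Config N M → ℝ) = density (Sum.inl ⟨x, hx⟩) := by
  funext ω
  simp only [eta, dif_pos hx, density]

lemma correlation_eq (μ : Config N M → ℝ) (s : ℝ) {x y : ℕ} (hx : x ∈ Finset.Icc 1 N)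
    (hy : y ∈ Finset.Icc 1 N) (hxy : x ≠ y) :
    correlation μ s x y = pairCorrelation μ s (Sum.inl ⟨x, hx⟩, Sum.inl ⟨y, hy⟩) := by
  have hne : (Sum.inl ⟨x, hx⟩ : Vertex N M) ≠ Sum.inl ⟨y, hy⟩ := fun h =>
    hxy (congrArg Subtype.val (Sum.inl.inj h))
  rw [pairCorrelation, offDiag_of_ne _ hne, correlation, eta_eq_density hx, eta_eq_density hy]
  rfl

lemma occ_mem_Icc (b : Bool) : occ b ∈ Set.Icc (0 : ℝ) 1 := by
  cases b <;> simp [occ]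

lemma resDensity_mem_Icc (n : Fin (M + 1)) : resDensity n ∈ Set.Icc (0 : ℝ) 1 := by
  have h : ((n : ℕ) : ℝ) ≤ M := by exact_mod_cast Nat.lt_succ_iff.1 n.2
  exact ⟨by unfold resDensity; positivity, div_le_one_of_le₀ h (by positivity)⟩

lemma density_mem_Icc (v : Vertex N M) (ω : Config N M) : density v ω ∈ Set.Icc (0 : ℝ) 1 := by
  rcases v with x | i | i
  · exact occ_mem_Icc _
  · exact resDensity_mem_Icc _
  · exact resDensity_mem_Icc _

lemma density_eq_of_pos_eq {v w : Vertex N M} (h : pos v = pos w) :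
    (density v : Config N M → ℝ) = density w := by
  rcases v with x | i | i <;> rcases w with y | j | j <;> simp only [pos] at h
  · rw [Subtype.ext h]
  · exact absurd h (by have := Finset.mem_Icc.1 x.2; omega)
  · exact absurd h (by have := Finset.mem_Icc.1 x.2; omega)
  · exact absurd h (by have := Finset.mem_Icc.1 y.2; omega)
  · rfl
  · omega
  · exact absurd h (by have := Finset.mem_Icc.1 y.2; omega)
  · omega
  · rfl

variable {μ : Config N M → ℝ}

lemma sum_mul_mem_Icc (hμ : μ ∈ stdSimplex ℝ (Config N M)) {f : Config N M → ℝ}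
    (hf : ∀ ω, f ω ∈ Set.Icc (0 : ℝ) 1) : ∑ ω, μ ω * f ω ∈ Set.Icc (0 : ℝ) 1 := by
  refine ⟨Finset.sum_nonneg fun ω _ => mul_nonneg (hμ.1 ω) (hf ω).1, ?_⟩
  rw [← hμ.2]
  exact Finset.sum_le_sum fun ω _ => mul_le_of_le_one_right (hμ.1 ω) (hf ω).2

/-- Subtracting the constant `v` from `Y` does not change the covariance. A concentrated variable is
thus almost uncorrelated with any bounded one. -/
lemma abs_covariance_le (hμ : μ ∈ stdSimplex ℝ (Config N M)) {X Y : Config N M → ℝ}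
    (hX : ∀ ω, X ω ∈ Set.Icc (0 : ℝ) 1) (v : ℝ) :
    |∑ ω, μ ω * (X ω * Y ω) - (∑ ω, μ ω * X ω) * ∑ ω, μ ω * Y ω|
      ≤ 2 * ∑ ω, μ ω * |Y ω - v| := by
  have e : ∑ ω, μ ω * (X ω * Y ω) - (∑ ω, μ ω * X ω) * ∑ ω, μ ω * Y ω
      = ∑ ω, μ ω * (X ω * (Y ω - v)) - (∑ ω, μ ω * X ω) * ∑ ω, μ ω * (Y ω - v) := by
    have e1 : ∑ ω, μ ω * (Y ω - v) = ∑ ω, μ ω * Y ω - v := by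
      simp only [mul_sub, Finset.sum_sub_distrib, ← Finset.sum_mul, hμ.2, one_mul]
    have e2 : ∑ ω, μ ω * (X ω * (Y ω - v)) = ∑ ω, μ ω * (X ω * Y ω) - (∑ ω, μ ω * X ω) * v := by
      rw [Finset.sum_mul, ← Finset.sum_sub_distrib]
      exact Finset.sum_congr rfl fun ω _ => by ring
    rw [e1, e2]; ring
  have h1 : |∑ ω, μ ω * (X ω * (Y ω - v))| ≤ ∑ ω, μ ω * |Y ω - v| := by
    refine (Finset.abs_sum_le_sum_abs _ _).trans (Finset.sum_le_sum fun ω _ => ?_)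
    rw [abs_mul, abs_mul, abs_of_nonneg (hμ.1 ω), abs_of_nonneg (hX ω).1]
    exact mul_le_mul_of_nonneg_left (mul_le_of_le_one_left (abs_nonneg _) (hX ω).2) (hμ.1 ω)
  have h2 : |∑ ω, μ ω * (Y ω - v)| ≤ ∑ ω, μ ω * |Y ω - v| := by
    refine (Finset.abs_sum_le_sum_abs _ _).trans (Finset.sum_le_sum fun ω _ => ?_)
    rw [abs_mul, abs_of_nonneg (hμ.1 ω)]
  have h3 := sum_mul_mem_Icc hμ hX
  rw [e]
  refine (abs_sub _ _).trans ?_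
  rw [abs_mul, abs_of_nonneg h3.1]
  have h4 := mul_le_of_le_one_left (abs_nonneg (∑ ω, μ ω * (Y ω - v))) h3.2
  linarith

/-- Sampling without replacement differs from sampling with replacement by `-ρ (1 - ρ) / (M - 1)`,
where `ρ` is the density. -/
lemma abs_pairDensity_sub_le (hM : 2 ≤ M) (n : Fin (M + 1)) :
    |pairDensity n - resDensity n * resDensity n| ≤ 1 / ((M : ℝ) - 1) := by
  have hM2 : (2 : ℝ) ≤ M := by exact_mod_cast hM
  have hM0 : (M : ℝ) ≠ 0 := by positivity
  have hM1 : (0 : ℝ) < M - 1 := by linarith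
  have e : pairDensity n - resDensity n * resDensity n
      = -(resDensity n * (1 - resDensity n) / (M - 1)) := by
    have := hM1.ne'
    unfold pairDensity resDensity
    field_simp
    ring
  have h := resDensity_mem_Icc n
  have h0 : 0 ≤ resDensity n * (1 - resDensity n) := mul_nonneg h.1 (by linarith [h.2])
  rw [e, abs_neg, abs_of_nonneg (by positivity)]
  exact div_le_div_of_nonneg_right (by nlinarith [h.1, h.2]) hM1.le

/-- The mean deviations of the densities of the reservoirs at time `0`, with an error term for the
exclusion in the reservoirs. -/
def reservoirError (μ : Config N M → ℝ) (vm vp : ℝ) : ℝ :=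
  2 * ∑ ω, μ ω * |leftDensity ω - vm| + 2 * ∑ ω, μ ω * |rightDensity ω - vp|
    + 1 / ((M : ℝ) - 1)

lemma abs_initial_reservoir_le (hM : 2 ≤ M) (hμ : μ ∈ stdSimplex ℝ (Config N M)) (vm vp : ℝ)
    (a : Vertex N M) (z : Fin M ⊕ Fin M) :
    |∑ ω, μ ω * density₂ a (Sum.inr z) ω
      - (∑ ω, μ ω * density a ω) * ∑ ω, μ ω * density (Sum.inr z) ω|
      ≤ reservoirError μ vm vp := by
  have hM2 : (2 : ℝ) ≤ M := by exact_mod_cast hM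
  have hM1 : 0 ≤ 1 / ((M : ℝ) - 1) := by
    have : (0 : ℝ) < M - 1 := by linarith
    positivity
  have hl : 0 ≤ ∑ ω, μ ω * |leftDensity ω - vm| :=
    Finset.sum_nonneg fun ω _ => mul_nonneg (hμ.1 ω) (abs_nonneg _)
  have hr : 0 ≤ ∑ ω, μ ω * |rightDensity ω - vp| :=
    Finset.sum_nonneg fun ω _ => mul_nonneg (hμ.1 ω) (abs_nonneg _)
  have hprod : |∑ ω, μ ω * (density a ω * density (Sum.inr z) ω)
      - (∑ ω, μ ω * density a ω) * ∑ ω, μ ω * density (Sum.inr z) ω|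
      ≤ 2 * ∑ ω, μ ω * |leftDensity ω - vm| + 2 * ∑ ω, μ ω * |rightDensity ω - vp| := by
    rcases z with i | i
    · refine (abs_covariance_le hμ (density_mem_Icc a) vm).trans ?_
      simp only [density]
      linarith
    · refine (abs_covariance_le hμ (density_mem_Icc a) vp).trans ?_
      simp only [density]
      linarith
  have hdiff : |∑ ω, μ ω * density₂ a (Sum.inr z) ω
      - ∑ ω, μ ω * (density a ω * density (Sum.inr z) ω)| ≤ 1 / ((M : ℝ) - 1) := by
    rw [← Finset.sum_sub_distrib]
    refine (Finset.abs_sum_le_sum_abs _ _).trans ?_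
    have : ∀ ω, |density₂ a (Sum.inr z) ω - density a ω * density (Sum.inr z) ω|
        ≤ 1 / ((M : ℝ) - 1) := by
      intro ω
      rcases a with x | i | i <;> rcases z with j | j <;>
        simp only [density₂, sub_self, abs_zero, hM1]
      · exact abs_pairDensity_sub_le hM _
      · exact abs_pairDensity_sub_le hM _
    calc _ ≤ ∑ ω, μ ω * (1 / ((M : ℝ) - 1)) := Finset.sum_le_sum fun ω _ => by
          rw [← mul_sub, abs_mul, abs_of_nonneg (hμ.1 ω)]
          exact mul_le_mul_of_nonneg_left (this ω) (hμ.1 ω)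
      _ = _ := by rw [← Finset.sum_mul, hμ.2, one_mul]
  unfold reservoirError
  have := abs_add_le (∑ ω, μ ω * density₂ a (Sum.inr z) ω
      - ∑ ω, μ ω * (density a ω * density (Sum.inr z) ω))
    (∑ ω, μ ω * (density a ω * density (Sum.inr z) ω)
      - (∑ ω, μ ω * density a ω) * ∑ ω, μ ω * density (Sum.inr z) ω)
  rw [sub_add_sub_cancel] at this
  linarith

/-- A bound for the correlations at time `s` in terms of a bound `ε + 2 β` for the correlations in
the channel at time `0`. -/
lemma abs_correlation_le (hN : 0 < N) (hM : 2 ≤ M) (hμ : μ ∈ stdSimplex ℝ (Config N M))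
    (vm vp : ℝ) {ε β : ℝ} (hε : 0 ≤ ε) (hβ : 0 ≤ β)
    (h0 : ∀ x ∈ Finset.Icc 1 N, ∀ y ∈ Finset.Icc 1 N, x ≠ y → |correlation μ 0 x y| ≤ ε + 2 * β)
    {s : ℝ} (hs : 0 < s) {x y : ℕ} (hx : x ∈ Finset.Icc 1 N) (hy : y ∈ Finset.Icc 1 N)
    (hxy : x ≠ y) :
    |correlation μ s x y| ≤ ε + reservoirError μ vm vp
      + β * (2 * (N / M) + ((x : ℝ) * (N + 1 - x) + (y : ℝ) * (N + 1 - y)) / s)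
      + sourceBound N M s := by
  have hM0 : 0 < M := by omega
  have hU0 : ∀ v, meanDensity μ 0 v = ∑ ω, μ ω * density v ω := fun v => expect_zero μ _
  have hxy' : (⟨x, hx⟩ : Site N) ≠ ⟨y, hy⟩ := fun h => hxy (congrArg Subtype.val h)
  have herr : 0 ≤ reservoirError μ vm vp :=
    (abs_nonneg _).trans (abs_initial_reservoir_le hM hμ vm vp (Sum.inl ⟨x, hx⟩)
      (Sum.inl ⟨0, hM0⟩))
  have hsource := abs_sub_flow_le_sourceBound hN hM0 (U := meanDensity μ)
    (K := pairCorrelation μ) (hasDerivAt_meanDensity hN hM μ)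
    (mem_lumped_of_forall fun v w h => by unfold meanDensity; rw [density_eq_of_pos_eq h])
    (fun v => by rw [hU0]; exact sum_mul_mem_Icc hμ (density_mem_Icc v))
    (hasDerivAt_pairCorrelation hN hM μ) hs hxy'
  -- For two channel sites the indicators of `channel` add up to `2`, which matches `ε + 2 * β`; all
  -- other pairs are covered by `reservoirError`. Only the `β` part profits from the escape from the
  -- channel.
  have hflow := abs_flow_pairGen_le hM0 (κ := ε + reservoirError μ vm vp) hβ
    (k := fun a b => expect μ 0 (density₂ a b) - meanDensity μ 0 a * meanDensity μ 0 b)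
    (fun a b hab => by
      have hres : ∀ a z, |expect μ 0 (density₂ a (Sum.inr z))
          - meanDensity μ 0 a * meanDensity μ 0 (Sum.inr z)| ≤ ε + reservoirError μ vm vp := by
        intro a z
        rw [expect_zero, hU0, hU0]
        linarith [abs_initial_reservoir_le hM hμ vm vp a z]
      have hch : 0 ≤ β * (channel N M a + channel N M b) :=
        mul_nonneg hβ (add_nonneg (channel_mem_Icc a).1 (channel_mem_Icc b).1)
      rcases b with b | z
      · rcases a with a | z
        · have hne : (a : ℕ) ≠ b := fun h => hab (congrArg _ (Subtype.ext h))
          have h1 := h0 a a.2 b b.2 hne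
          rw [correlation_eq μ 0 a.2 b.2 hne, pairCorrelation, offDiag_of_ne _ hab] at h1
          rw [channel_site, channel_site]
          linarith
        · rw [density₂_symm, mul_comm]
          linarith [hres (Sum.inl b) z]
      · linarith [hres a z]) hs hxy'
  rw [correlation_eq μ s hx hy hxy]
  have e : pairCorrelation μ 0 = offDiag
    fun a b => expect μ 0 (density₂ a b) - meanDensity μ 0 a * meanDensity μ 0 b := rfl
  rw [e] at hsource
  have h1 := abs_sub_abs_le_abs_sub (pairCorrelation μ s (Sum.inl ⟨x, hx⟩, Sum.inl ⟨y, hy⟩))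
    (flow (pairGen (rate N M)) s (offDiag
      fun a b => expect μ 0 (density₂ a b) - meanDensity μ 0 a * meanDensity μ 0 b)
      (Sum.inl ⟨x, hx⟩, Sum.inl ⟨y, hy⟩))
  linarith

lemma abs_correlation_zero_le (hμ : μ ∈ stdSimplex ℝ (Config N M)) {x y : ℕ}
    (hx : x ∈ Finset.Icc 1 N) (hy : y ∈ Finset.Icc 1 N) : |correlation μ 0 x y| ≤ 1 := by
  rw [correlation, eta_eq_density hx, eta_eq_density hy, expect_zero, expect_zero, expect_zero]
  have h1 := sum_mul_mem_Icc hμ (density_mem_Icc (Sum.inl ⟨x, hx⟩))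
  have h2 := sum_mul_mem_Icc hμ (density_mem_Icc (Sum.inl ⟨y, hy⟩))
  have h3 := sum_mul_mem_Icc hμ (f := fun ω => density (Sum.inl ⟨x, hx⟩) ω
    * density (Sum.inl ⟨y, hy⟩) ω) (fun ω => by
      have a1 := density_mem_Icc (Sum.inl ⟨x, hx⟩) ω
      have a2 := density_mem_Icc (Sum.inl ⟨y, hy⟩) ω
      exact ⟨mul_nonneg a1.1 a2.1, mul_le_one₀ a1.2 a2.1 a2.2⟩)
  have h4 := mul_nonneg h1.1 h2.1
  have h5 := mul_le_one₀ h1.2 h2.1 h2.2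
  rw [abs_le]
  constructor <;> linarith [h3.1, h3.2]

end Expectation

/-! ### Limits of the error terms -/

section Asymptotics

variable {N M : ℕ}

lemma sum_mul_abs_le_add_prob {μ : Config N M → ℝ} (hμ : μ ∈ stdSimplex ℝ (Config N M))
    {X : Config N M → ℝ} (hX : ∀ ω, |X ω| ≤ 1) {δ : ℝ} (hδ : 0 ≤ δ) :
    ∑ ω, μ ω * |X ω| ≤ δ + prob μ (fun ω => δ < |X ω|) := by
  have h : ∑ ω, μ ω * δ = δ := by rw [← Finset.sum_mul, hμ.2, one_mul]
  unfold prob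
  refine le_trans ?_ (add_le_add h.le le_rfl)
  rw [← Finset.sum_add_distrib]
  refine Finset.sum_le_sum fun ω _ => ?_
  have h0 := hμ.1 ω
  split_ifs with hc
  · nlinarith [hX ω, mul_nonneg h0 hδ]
  · rw [add_zero]
    exact mul_le_mul_of_nonneg_left (not_lt.1 hc) h0

/-- For uniformly bounded variables convergence in probability implies convergence in mean. -/
lemma tendsto_sum_mul_abs {m : ℕ → ℕ} {μ : (N : ℕ) → Config N (m N) → ℝ}
    (hμ : ∀ N, μ N ∈ stdSimplex ℝ (Config N (m N))) {X : (N : ℕ) → Config N (m N) → ℝ}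
    (hX : ∀ N ω, |X N ω| ≤ 1)
    (h : ∀ δ > 0, Tendsto (fun N => prob (μ N) (fun ω => δ < |X N ω|)) atTop (𝓝 0)) :
    Tendsto (fun N => ∑ ω, μ N ω * |X N ω|) atTop (𝓝 0) := by
  refine tendsto_order.2 ⟨fun a ha => Eventually.of_forall fun N => ha.trans_le ?_, fun a ha => ?_⟩
  · exact Finset.sum_nonneg fun ω _ => mul_nonneg ((hμ N).1 ω) (abs_nonneg _)
  · filter_upwards [(tendsto_order.1 (h (a / 2) (half_pos ha))).2 (a / 2) (half_pos ha)] with N hN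
    have := sum_mul_abs_le_add_prob (hμ N) (hX N) (half_pos ha).le
    linarith

lemma abs_sub_le_one {a b : ℝ} (ha : a ∈ Set.Icc (0 : ℝ) 1) (hb : b ∈ Set.Icc (0 : ℝ) 1) :
    |a - b| ≤ 1 := by
  rw [abs_le]
  constructor <;> linarith [ha.1, ha.2, hb.1, hb.2]

variable {α : ℝ}

lemma resSize_ge (hα : 0 < α) : ∀ᶠ N : ℕ in atTop, (N : ℝ) ^ (1 + α) / 2 ≤ resSize α N := by
  have h : Tendsto (fun N : ℕ => (N : ℝ) ^ (1 + α)) atTop atTop :=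
    (tendsto_rpow_atTop (by linarith)).comp tendsto_natCast_atTop_atTop
  filter_upwards [h.eventually_ge_atTop 2] with N hN
  have := Nat.sub_one_lt_floor ((N : ℝ) ^ (1 + α))
  unfold resSize
  linarith

lemma tendsto_natCast_rpow_neg {p : ℝ} (hp : 0 < p) :
    Tendsto (fun N : ℕ => (N : ℝ) ^ (-p)) atTop (𝓝 0) :=
  (tendsto_rpow_neg_atTop hp).comp tendsto_natCast_atTop_atTop

lemma tendsto_div_resSize (hα : 0 < α) :
    Tendsto (fun N : ℕ => (N : ℝ) / resSize α N) atTop (𝓝 0) := by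
  have h : Tendsto (fun N : ℕ => 2 * (N : ℝ) ^ (-α)) atTop (𝓝 0) := by
    simpa using (tendsto_natCast_rpow_neg hα).const_mul 2
  refine squeeze_zero' (Eventually.of_forall fun N => by positivity) ?_ h
  filter_upwards [resSize_ge hα, eventually_gt_atTop 0] with N hN h0
  have hN0 : (0 : ℝ) < N := by positivity
  have hp : 0 < (N : ℝ) ^ (1 + α) / 2 := by positivity
  calc (N : ℝ) / resSize α N ≤ N / ((N : ℝ) ^ (1 + α) / 2) :=
        div_le_div_of_nonneg_left hN0.le hp hN
    _ = 2 * (N : ℝ) ^ (-α) := by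
        rw [Real.rpow_add hN0, Real.rpow_one, Real.rpow_neg hN0.le]
        field_simp

lemma tendsto_resSize (hα : 0 < α) : Tendsto (fun N : ℕ => (resSize α N : ℝ)) atTop atTop := by
  have h : Tendsto (fun N : ℕ => (N : ℝ) ^ (1 + α) / 2) atTop atTop :=
    Tendsto.atTop_div_const (by norm_num)
      ((tendsto_rpow_atTop (by linarith)).comp tendsto_natCast_atTop_atTop)
  exact tendsto_atTop_mono' _ (resSize_ge hα) h

lemma tendsto_reservoirError (hα : 0 < α) {u₀ : ℝ → ℝ} {vm vp : ℝ}
    (hvm : vm ∈ Set.Icc (0 : ℝ) 1) (hvp : vp ∈ Set.Icc (0 : ℝ) 1)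
    {μ : (N : ℕ) → Config N (resSize α N) → ℝ} (hμ : InitialAssumption α u₀ vm vp μ) :
    Tendsto (fun N => reservoirError (μ N) vm vp) atTop (𝓝 0) := by
  have h1 := tendsto_sum_mul_abs hμ.isProb (X := fun N ω => leftDensity ω - vm)
    (fun N ω => abs_sub_le_one (resDensity_mem_Icc ω.2.1) hvm) hμ.left_tendsto
  have h2 := tendsto_sum_mul_abs hμ.isProb (X := fun N ω => rightDensity ω - vp)
    (fun N ω => abs_sub_le_one (resDensity_mem_Icc ω.2.2) hvp) hμ.right_tendsto
  have h3 : Tendsto (fun N : ℕ => 1 / ((resSize α N : ℝ) - 1)) atTop (𝓝 0) := by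
    have : Tendsto (fun N : ℕ => (resSize α N : ℝ) - 1) atTop atTop :=
      tendsto_atTop_add_const_right _ (-1) (tendsto_resSize hα)
    simp only [one_div]
    exact this.inv_tendsto_atTop
  simpa [reservoirError] using ((h1.const_mul 2).add (h2.const_mul 2)).add h3

/-- With `s = N^(2+α') t` and `M ≥ N^(1+α) / 2` the terms of the bound are `N / s = O(1 / N)`, `1 /
N`, `N / M^2 ≤ N / M`, `s / (N M^2) = O(N^(-(1+2α-α')))`, and a logarithm `log (1 + s / 2) / N` with
the bounded factor `4 N^2 / s + 1`. -/
lemma tendsto_sourceBound {α' t : ℝ} (hα : 0 < α) (hα' : 0 ≤ α') (hαα' : α' < α) (ht : 0 < t) :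
    Tendsto (fun N : ℕ => sourceBound N (resSize α N) ((N : ℝ) ^ (2 + α') * t)) atTop (𝓝 0) := by
  have h1 : Tendsto (fun N : ℕ => 1 / (N : ℝ)) atTop (𝓝 0) := tendsto_one_div_atTop_nhds_zero_nat
  have h2 := tendsto_div_resSize hα
  have h3 : Tendsto (fun N : ℕ => (N : ℝ) ^ (-(1 + 2 * α - α'))) atTop (𝓝 0) :=
    tendsto_natCast_rpow_neg (by linarith)
  have h4 : Tendsto (fun N : ℕ => Real.log N / N) atTop (𝓝 0) := by
    have := Real.isLittleO_log_id_atTop.tendsto_div_nhds_zero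
    exact this.comp tendsto_natCast_atTop_atTop
  have hlim : Tendsto (fun N : ℕ => 4 * (128 / t * (1 / (N : ℝ)) + 32 * (1 / (N : ℝ))
      + 32 * ((N : ℝ) / resSize α N) + 32 * t * (N : ℝ) ^ (-(1 + 2 * α - α'))
      + 32 * (4 / t + 1) * (Real.log (1 + t) * (1 / (N : ℝ)) + (2 + α') * (Real.log N / N))))
      atTop (𝓝 0) := by
    have := ((((((h1.const_mul (128 / t)).add (h1.const_mul 32)).add (h2.const_mul 32)).add
      (h3.const_mul (32 * t))).add (((h1.const_mul (Real.log (1 + t))).add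
        (h4.const_mul (2 + α'))).const_mul (32 * (4 / t + 1)))).const_mul 4)
    simpa using this
  have hnn : ∀ᶠ N : ℕ in atTop, 0 ≤ sourceBound N (resSize α N) ((N : ℝ) ^ (2 + α') * t) := by
    refine Eventually.of_forall fun N => ?_
    have hs : 0 ≤ (N : ℝ) ^ (2 + α') * t := by positivity
    have : 0 ≤ Real.log (1 + (N : ℝ) ^ (2 + α') * t / 2) := Real.log_nonneg (by linarith)
    unfold sourceBound
    positivity
  refine squeeze_zero' hnn ?_ hlim
  filter_upwards [resSize_ge hα, (tendsto_resSize hα).eventually_ge_atTop 1,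
    eventually_ge_atTop 1] with N hM hM1 hN
  have hN1 : (1 : ℝ) ≤ N := by exact_mod_cast hN
  have hN0 : (0 : ℝ) < N := by linarith
  set M : ℝ := (resSize α N : ℝ) with hMdef
  have hM0 : 0 < M := by linarith
  set s : ℝ := (N : ℝ) ^ (2 + α') * t with hs
  have hpow : (N : ℝ) ^ 2 ≤ (N : ℝ) ^ (2 + α') := by
    rw [← Real.rpow_natCast]
    exact Real.rpow_le_rpow_of_exponent_le hN1 (by push_cast; linarith)
  have hs0 : 0 < s := by positivity
  have hsN : (N : ℝ) ^ 2 * t ≤ s := mul_le_mul_of_nonneg_right hpow ht.le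
  have b1 : (N : ℝ) / s ≤ 1 / t * (1 / N) := by
    rw [div_mul_div_comm, one_mul, div_le_div_iff₀ hs0 (by positivity)]
    nlinarith
  have b1' : (N : ℝ) ^ 2 / s ≤ 1 / t := by
    rw [div_le_div_iff₀ hs0 ht]
    linarith
  have b2 : (N : ℝ) / M ^ 2 ≤ N / M := by
    apply div_le_div_of_nonneg_left hN0.le hM0
    nlinarith
  have b3 : s / (N * M ^ 2) ≤ 4 * t * (N : ℝ) ^ (-(1 + 2 * α - α')) := by
    have hM2 : ((N : ℝ) ^ (1 + α) / 2) ^ 2 ≤ M ^ 2 := pow_le_pow_left₀ (by positivity) hM 2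
    have hpos : 0 < (N : ℝ) * ((N : ℝ) ^ (1 + α) / 2) ^ 2 := by positivity
    calc s / (N * M ^ 2) ≤ s / (N * ((N : ℝ) ^ (1 + α) / 2) ^ 2) :=
          div_le_div_of_nonneg_left hs0.le hpos (mul_le_mul_of_nonneg_left hM2 hN0.le)
      _ = 4 * t * (N : ℝ) ^ (-(1 + 2 * α - α')) := by
          have e1 : -(1 + 2 * α - α') = (2 + α') - 1 - (1 + α) - (1 + α) := by ring
          rw [e1, Real.rpow_sub hN0, Real.rpow_sub hN0, Real.rpow_sub hN0, Real.rpow_one, hs]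
          have : (0 : ℝ) < (N : ℝ) ^ (1 + α) := by positivity
          field_simp
          ring
  have b4 : Real.log (1 + s / 2) / N
      ≤ Real.log (1 + t) * (1 / N) + (2 + α') * (Real.log N / N) := by
    have h5 : 1 + s / 2 ≤ (1 + t) * (N : ℝ) ^ (2 + α') := by
      have : (1 : ℝ) ≤ (N : ℝ) ^ (2 + α') := Real.one_le_rpow hN1 (by linarith)
      rw [hs]; nlinarith
    have h6 : Real.log (1 + s / 2) ≤ Real.log (1 + t) + (2 + α') * Real.log N := by
      rw [← Real.log_rpow hN0, ← Real.log_mul (by positivity) (by positivity)]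
      exact Real.log_le_log (by positivity) h5
    calc _ ≤ (Real.log (1 + t) + (2 + α') * Real.log N) / N :=
          div_le_div_of_nonneg_right h6 hN0.le
      _ = _ := by ring
  have hl : 0 ≤ Real.log (1 + s / 2) / N :=
    div_nonneg (Real.log_nonneg (by linarith)) hN0.le
  have e : sourceBound N (resSize α N) s = 4 * (128 * ((N : ℝ) / s) + 32 * (1 / (N : ℝ))
      + 32 * ((N : ℝ) / M ^ 2) + 8 * (s / (N * M ^ 2))
      + 32 * (4 * ((N : ℝ) ^ 2 / s) + 1) * (Real.log (1 + s / 2) / N)) := by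
    rw [sourceBound, ← hMdef]
    field_simp
    ring
  have b5 : 32 * (4 * ((N : ℝ) ^ 2 / s) + 1) * (Real.log (1 + s / 2) / N)
      ≤ 32 * (4 / t + 1) * (Real.log (1 + t) * (1 / N) + (2 + α') * (Real.log N / N)) := by
    refine mul_le_mul ?_ b4 hl (by positivity)
    have : 4 / t = 4 * (1 / t) := by ring
    rw [this]
    linarith
  rw [e]
  have b6 : 128 / t * (1 / (N : ℝ)) = 128 * (1 / t * (1 / N)) := by ring
  rw [b6]
  linarith

/-- The contribution of the pairs of walkers which stay in the channel, for sites `x` with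
`x ≤ d`. -/
lemma mul_div_le {N x d : ℕ} (hx : x ∈ Finset.Icc 1 N) (hd : x ≤ d) {s : ℝ} (hs : 0 < s) :
    (x : ℝ) * (N + 1 - x) / s ≤ d * N / s := by
  have h := Finset.mem_Icc.1 hx
  have h1 : (1 : ℝ) ≤ x := by exact_mod_cast h.1
  have h2 : (x : ℝ) ≤ N := by exact_mod_cast h.2
  have h3 : (x : ℝ) ≤ d := by exact_mod_cast hd
  apply div_le_div_of_nonneg_right _ hs.le
  exact mul_le_mul h3 (by linarith) (by linarith) (by linarith)

end Asymptotics

end ReservoirSSEP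

end

/-! ### Propagation of chaos -/

open ReservoirSSEP

theorem mainTheorem3 (α α' : ℝ) (hα : 0 < α) (hα' : 0 ≤ α') (hαα' : α' < α)
    (u₀ : ℝ → ℝ) (hu₀ : ContinuousOn u₀ (Set.Ioo 0 1))
    (hu₀_mem : ∀ r ∈ Set.Ioc (0 : ℝ) 1, u₀ r ∈ Set.Icc (0 : ℝ) 1)
    (vm vp : ℝ) (hvm : vm ∈ Set.Icc (0 : ℝ) 1) (hvp : vp ∈ Set.Icc (0 : ℝ) 1)
    (μ : (N : ℕ) → ReservoirSSEP.Config N (ReservoirSSEP.resSize α N) → ℝ)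
    (hμ : ReservoirSSEP.InitialAssumption α u₀ vm vp μ)
    (t : ℝ) (ht : 0 < t) :
    (∀ x₁ x₂ : ℕ, 1 ≤ x₁ → 1 ≤ x₂ → x₁ ≠ x₂ →
      Tendsto (fun N : ℕ =>
        |ReservoirSSEP.correlation (μ N) ((N : ℝ) ^ (2 + α') * t) x₁ x₂|) atTop (𝓝 0)) ∧
    (0 < α' ∨ ReservoirSSEP.UniformlyDecorrelated α μ (fun _ => 0) →
      ReservoirSSEP.UniformlyDecorrelated α μ (fun N => (N : ℝ) ^ (2 + α') * t)) := by
  have hpos : ∀ N : ℕ, 1 ≤ N → 0 < (N : ℝ) ^ (2 + α') * t := fun N hN => by positivity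
  have hM2 : ∀ᶠ N : ℕ in atTop, 2 ≤ resSize α N := by
    filter_upwards [(tendsto_resSize hα).eventually_ge_atTop 2] with N hN
    exact_mod_cast hN
  have herr := tendsto_reservoirError hα hvm hvp hμ
  have hsrc := tendsto_sourceBound hα hα' hαα' ht
  have hNM := tendsto_div_resSize hα
  have hmain : ∀ N : ℕ, 1 ≤ N → 2 ≤ resSize α N → ∀ d : ℕ, ∀ x ∈ Finset.Icc 1 N,
      ∀ y ∈ Finset.Icc 1 N, x ≠ y → x ≤ d → y ≤ d →
      |correlation (μ N) ((N : ℝ) ^ (2 + α') * t) x y| ≤ reservoirError (μ N) vm vp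
        + (N / resSize α N + d * N / ((N : ℝ) ^ (2 + α') * t))
        + sourceBound N (resSize α N) ((N : ℝ) ^ (2 + α') * t) := by
    intro N hN hM d x hx y hy hxy hxd hyd
    -- No information on the initial correlations is used beyond the trivial bound `1 = 0 + 2 * (1 /
    -- 2)`, so everything is left to the escape from the channel.
    have h := abs_correlation_le hN hM (hμ.isProb N) vm vp (ε := 0) (β := 1 / 2) le_rfl
      (by norm_num) (fun x hx y hy _ => (abs_correlation_zero_le (hμ.isProb N) hx hy).trans
        (by norm_num)) (hpos N hN) hx hy hxy
    have h1 := mul_div_le hx hxd (hpos N hN)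
    have h2 := mul_div_le hy hyd (hpos N hN)
    rw [add_div] at h
    linarith
  have hpow : ∀ N : ℕ, 1 ≤ N → (N : ℝ) / ((N : ℝ) ^ (2 + α') * t)
      = 1 / t * (N : ℝ) ^ (-(1 + α')) := by
    intro N hN
    have hN0 : (0 : ℝ) < N := by positivity
    have e : -(1 + α') = 1 - (2 + α') := by ring
    rw [e, Real.rpow_sub hN0, Real.rpow_one]
    field_simp
  refine ⟨fun x₁ x₂ h₁ h₂ h₁₂ => ?_, ?_⟩
  · have h3 : Tendsto (fun N : ℕ => reservoirError (μ N) vm vp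
        + (N / resSize α N + ((max x₁ x₂ : ℕ) : ℝ) * (1 / t * (N : ℝ) ^ (-(1 + α'))))
        + sourceBound N (resSize α N) ((N : ℝ) ^ (2 + α') * t)) atTop (𝓝 0) := by
      have := (herr.add (hNM.add (((tendsto_natCast_rpow_neg
        (show 0 < 1 + α' by linarith)).const_mul (1 / t)).const_mul
          ((max x₁ x₂ : ℕ) : ℝ)))).add hsrc
      simpa only [mul_zero, add_zero] using this
    refine squeeze_zero' (Eventually.of_forall fun N => abs_nonneg _) ?_ h3
    filter_upwards [hM2, eventually_ge_atTop (max x₁ x₂), eventually_ge_atTop 1] with N hM hN hN1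
    have h := hmain N hN1 hM (max x₁ x₂) x₁ (Finset.mem_Icc.2 ⟨h₁, (le_max_left _ _).trans hN⟩)
      x₂ (Finset.mem_Icc.2 ⟨h₂, (le_max_right _ _).trans hN⟩) h₁₂ (le_max_left _ _)
      (le_max_right _ _)
    rwa [mul_div_assoc, hpow N hN1] at h
  · rintro (hα'pos | hdec) ε hε
    · have h3 : Tendsto (fun N : ℕ => reservoirError (μ N) vm vp
          + (N / resSize α N + 1 / t * (N : ℝ) ^ (-α'))
          + sourceBound N (resSize α N) ((N : ℝ) ^ (2 + α') * t)) atTop (𝓝 0) := by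
        have := (herr.add (hNM.add ((tendsto_natCast_rpow_neg hα'pos).const_mul (1 / t)))).add hsrc
        simpa only [mul_zero, add_zero] using this
      filter_upwards [hM2, eventually_ge_atTop 1, (tendsto_order.1 h3).2 ε hε]
        with N hM hN hlt x hx y hy hxy
      -- For arbitrary sites `d = N`, and `N^2 / s` is of order `N^(-α')`, which vanishes only for
      -- `α' > 0`.
      have h := hmain N hN hM N x hx y hy hxy (Finset.mem_Icc.1 hx).2 (Finset.mem_Icc.1 hy).2
      have hN0 : (0 : ℝ) < N := by positivity
      have e : (N : ℝ) * N / ((N : ℝ) ^ (2 + α') * t) = 1 / t * (N : ℝ) ^ (-α') := by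
        have e1 : -α' = 1 + -(1 + α') := by ring
        rw [mul_div_assoc, hpow N hN, e1, Real.rpow_add hN0, Real.rpow_one]
        ring
      rw [e] at h
      exact h.trans_lt hlt
    · have h3 : Tendsto (fun N : ℕ => reservoirError (μ N) vm vp
          + sourceBound N (resSize α N) ((N : ℝ) ^ (2 + α') * t)) atTop (𝓝 0) := by
        simpa only [add_zero] using herr.add hsrc
      filter_upwards [hM2, eventually_ge_atTop 1, (tendsto_order.1 h3).2 (ε / 2) (half_pos hε),
        hdec (ε / 2) (half_pos hε)] with N hM hN hlt hd x hx y hy hxy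
      -- With `β = 0` the escape from the channel plays no role: the initial bound `ε / 2` is merely
      -- propagated.
      have h := abs_correlation_le hN hM (hμ.isProb N) vm vp (half_pos hε).le (le_refl (0 : ℝ))
        (fun x hx y hy hxy => by rw [mul_zero, add_zero]; exact (hd x hx y hy hxy).le)
        (hpos N hN) hx hy hxy
      rw [zero_mul] at h
      linarith
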